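/- Consider the class of equations $$\hat u_t+x^{2\gamma}\hat u_{xx}-\hat f(x,\hat u)=0,\qquad x>0,$$ whose arbitrary elements are the constant $\gamma\in\mathbb R$ and the smooth real function $\hat f$ of $(x,\hat u)$. An *equivalence transformation* of the class, over a box $D=I\times J\times K\times L\times M$ of nonempty open intervals ($I\subseteq(0,\infty)$) in the space of $(x,t,\hat u,\gamma,\hat f)$, is a smooth diffeomorphism $(x,t,\hat u,\gamma,\hat f)\mapsto(\bar x,\bar t,\bar u,\bar\gamma,\bar f)$ of $D$ onto an open set in $\{\bar x>0\}$, such that $\bar x,\bar t,\bar u$ depend on $(x,t,\hat u)$ only, and which maps every equation of the class to an equation of the class (arbitrary elements to arbitrary elements, solutions to solutions and non-solutions to non-solutions). The *continuous part* $\hat{\mathcal E}_{\mathcal C}$ over $D$ consists of the equivalence transformations over $D$ that are joined to the identity by a family of equivalence transformations over $D$ depending smoothly on a parameter $s\in[0,1]$. For constants $\zeta_0,\zeta_1,\zeta_2$ and a smooth function $\mathcal F:I\to\mathbb R$ consider the transformation $$\bar x=x^{\frac1{\zeta_2^2}},\quad \bar t=\zeta_0+\frac1{\zeta_2^4}t,\quad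 \bar u=x^{\frac12\left(\frac1{\zeta_2^2}-1\right)}\bigl(\zeta_1\hat u+\mathcal F(x)\bigr),\quad \bar\gamma=1+\zeta_2^2(\gamma-1),$$ $$\bar f=\tfrac14x^{\frac12\left(\frac1{\zeta_2^2}-5\right)}\Bigl((\zeta_2^4-1)x^{2\gamma}\bigl(\zeta_1\hat u+\mathcal F(x)\bigr)+4\zeta_2^4x^2\bigl(\zeta_1\hat f+x^{2\gamma}\mathcal F''(x)\bigr)\Bigr).\qquad(*)$$ (a) The continuous part $\hat{\mathcal E}_{\mathcal C}$ over $D$ consists exactly of the transformations $(*)$ with $\zeta_0\in\mathbb R$, $\zeta_1>0$, $\zeta_2\neq0$ and $\mathcal F$ an arbitrary smooth function on $I$. (b) The transformations $(*)$ with $\zeta_0\in\mathbb R$, $\zeta_1\zeta_2\ne0$ and $\mathcal F$ an arbitrary smooth function on $I$ are exactly the equivalence transformations over $D$ that belong to $\hat{\mathcal E}_{\mathcal C}$, either themselves or after composition with the discrete transformation $\bar u\mapsto-\bar u$, $\bar f\mapsto-\bar f$. -/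

import Mathlib

open scoped ContDiff
open Set

/-- The extended space with coordinates `(x, t, u, γ, f)`. -/
abbrev ExtSpace : Type := ℝ × ℝ × ℝ × ℝ × ℝ

namespace ExtSpace

def x (z : ExtSpace) : ℝ := z.1
def t (z : ExtSpace) : ℝ := z.2.1
def u (z : ExtSpace) : ℝ := z.2.2.1
def γ (z : ExtSpace) : ℝ := z.2.2.2.1
def f (z : ExtSpace) : ℝ := z.2.2.2.2

end ExtSpace

/-- `u = u(x,t)` is a smooth solution, on the set `W` of points `(x,t)`, of the equation
`u_t + x^(2γ) u_xx - f(x,u) = 0`. It is used for open sets `W` in the half-plane `x > 0`. -/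
def IsSolutionOn (γ : ℝ) (f : ℝ → ℝ → ℝ) (W : Set (ℝ × ℝ)) (u : ℝ → ℝ → ℝ) : Prop :=
  ContDiffOn ℝ ∞ (Function.uncurry u) W ∧
    ∀ x t : ℝ, (x, t) ∈ W →
      deriv (fun s => u x s) t + x ^ (2 * γ) * iteratedDeriv 2 (fun y => u y t) x
        - f x (u x t) = 0

/-- The points `(x, t, u, γ, f(x,u))` of the extended space given by the arbitrary elements
`γ` (a constant) and `f` (a function of `(x,u)`, considered on `V`). -/
def elementGraph (γ : ℝ) (f : ℝ → ℝ → ℝ) (V : Set (ℝ × ℝ)) : Set ExtSpace :=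
  {z | (z.x, z.u) ∈ V ∧ z.γ = γ ∧ z.f = f z.x z.u}

/-- The graph over `W` of a function `u = u(x,t)`, lifted to the extended space by the
arbitrary elements `γ` and `f`. -/
def liftedGraph (γ : ℝ) (f : ℝ → ℝ → ℝ) (W : Set (ℝ × ℝ)) (u : ℝ → ℝ → ℝ) : Set ExtSpace :=
  (fun p : ℝ × ℝ => ((p.1, p.2, u p.1 p.2, γ, f p.1 (u p.1 p.2)) : ExtSpace)) '' W

/-- `Ψ` is an equivalence transformation, defined on the open part `D` of the extended space,
of the class of equations `u_t + x^(2γ) u_xx - f(x,u) = 0` on `x > 0`, with arbitrary elements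
`γ` (a real constant) and `f` (a smooth function of `(x,u)`). -/
structure IsEquivalenceTransformation (D : Set ExtSpace) (Ψ : ExtSpace → ExtSpace) : Prop where
  smooth : ContDiffOn ℝ ∞ Ψ D
  isOpen_image : IsOpen (Ψ '' D)
  smooth_inverse : ∃ Θ : ExtSpace → ExtSpace, ContDiffOn ℝ ∞ Θ (Ψ '' D) ∧ LeftInvOn Θ Ψ D
  /-- the transformed equation again lives on the half-line `x > 0` -/
  pos : ∀ z ∈ D, 0 < (Ψ z).x
  /-- the new `x, t, u` are functions of the old `x, t, u` only -/
  projectable : ∀ z ∈ D, ∀ w ∈ D, z.x = w.x → z.t = w.t → z.u = w.u →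
    (Ψ z).x = (Ψ w).x ∧ (Ψ z).t = (Ψ w).t ∧ (Ψ z).u = (Ψ w).u
  /-- each equation of the class, with elements `γ, f`, is mapped to an equation of the class,
  with elements `γ', f'`: the elements are mapped to each other, and a function solves the first
  equation if and only if its transform solves the second one -/
  maps_class : ∀ (γ : ℝ) (f : ℝ → ℝ → ℝ) (V : Set (ℝ × ℝ)),
    IsOpen V → ContDiffOn ℝ ∞ (Function.uncurry f) V →
    ∃ (γ' : ℝ) (f' : ℝ → ℝ → ℝ),
      ContDiffOn ℝ ∞ (Function.uncurry f')
        ((fun z => ((Ψ z).x, (Ψ z).u)) '' (elementGraph γ f V ∩ D)) ∧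
      (∀ z ∈ elementGraph γ f V ∩ D, (Ψ z).γ = γ' ∧ (Ψ z).f = f' (Ψ z).x (Ψ z).u) ∧
      ∀ (W W' : Set (ℝ × ℝ)) (u v : ℝ → ℝ → ℝ), IsOpen W → IsOpen W' →
        ContDiffOn ℝ ∞ (Function.uncurry u) W → ContDiffOn ℝ ∞ (Function.uncurry v) W' →
        liftedGraph γ f W u ⊆ elementGraph γ f V ∩ D →
        Ψ '' liftedGraph γ f W u = liftedGraph γ' f' W' v →
        (IsSolutionOn γ f W u ↔ IsSolutionOn γ' f' W' v)

/-- The continuous part of the equivalence group over `D`: the equivalence transformations that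
are joined to the identity by a smooth one-parameter family of equivalence transformations. -/
def InContinuousPart (D : Set ExtSpace) (Ψ : ExtSpace → ExtSpace) : Prop :=
  ∃ H : ℝ → ExtSpace → ExtSpace,
    ContDiffOn ℝ ∞ (fun q : ℝ × ExtSpace => H q.1 q.2) (Icc (0 : ℝ) 1 ×ˢ D) ∧
    (∀ s ∈ Icc (0 : ℝ) 1, IsEquivalenceTransformation D (H s)) ∧
    EqOn (H 0) id D ∧ EqOn (H 1) Ψ D

/-- The transformation with parameters `ζ₀, ζ₁, ζ₂` and parameter function `F`. -/
noncomputable def familyMap (ζ₀ ζ₁ ζ₂ : ℝ) (F : ℝ → ℝ) (z : ExtSpace) : ExtSpace :=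
  (z.x ^ (1 / ζ₂ ^ 2),
   ζ₀ + 1 / ζ₂ ^ 4 * z.t,
   z.x ^ ((1 / 2 : ℝ) * (1 / ζ₂ ^ 2 - 1)) * (ζ₁ * z.u + F z.x),
   1 + ζ₂ ^ 2 * (z.γ - 1),
   (1 / 4 : ℝ) * z.x ^ ((1 / 2 : ℝ) * (1 / ζ₂ ^ 2 - 5)) *
     ((ζ₂ ^ 4 - 1) * z.x ^ (2 * z.γ) * (ζ₁ * z.u + F z.x)
       + 4 * ζ₂ ^ 4 * z.x ^ 2 * (ζ₁ * z.f + z.x ^ (2 * z.γ) * iteratedDeriv 2 F z.x)))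

/-- The discrete transformation `u ↦ -u, f ↦ -f`. -/
def reflection (z : ExtSpace) : ExtSpace := (z.x, z.t, -z.u, z.γ, -z.f)

/-! Every equivalence transformation over a box, connected to the identity or not, is a `powerMap`
with exponent `c ≠ 0` and factor `ζ₁ ≠ 0` (`exists_powerMap`), and conversely
(`isEquivalenceTransformation_of_eqOn_powerMap`). Both claims then become questions of sign. The
values `1 / ζ₂ ^ 2` are exactly the positive exponents, `reflection` flips the signs of `ζ₁` and
`F`, and neither `c` nor `ζ₁` can change sign along a path of equivalence transformations.
Conversely, positive parameters are joined to the identity by linear interpolation. Negative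
exponents also give equivalence transformations, but these are in neither of the two families.

Necessity exploits the freedom in `f`. A smooth `f` can take prescribed values at two points with
different `(x, u)`. Hence the new `γ` depends on `γ` alone, and the new `x` and `u` do not involve
`t` (`gamma_eq`, `fiber`, `fderiv_t`). Next, the transformed equation is evaluated on explicit
solutions `testFun` with `u_x = p`, `u_t = q`, `u_xx = r`, `u_tt = k q` at one point
(`jet_identity`). The element `f` has the value `q + x^(2γ) r` there, and the new `f` depends only
on the point of the extended space. So different jets with the same `f` yield separate relations. On
stationary solutions, varying `p` gives `X_u = 0` (with the help of two values of `f`), then `U_uu =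
0` and `2 U_xu X_x = U_u X_xx`. Varying `k` gives `T_x = T_u = 0`. Comparing `q = 1` with `q = 0`
gives `X_x² x^(2γ) = T_t X^(2 g(γ))`.

The last relation, used for several `γ`, forces `X = x^c`, and then `g(γ) = 1 + (γ - 1) / c` and
`T_t = c²`. The others make `U` affine in `u` with weight `x^((c-1)/2)`, and the new `f` is read off
from the stationary relation.

For sufficiency the inverse is explicit, and the left-hand side of the equation is merely multiplied
by the nonvanishing factor `x^((c-1)/2) ζ₁ / c²` (`equation_transform`). -/

/-! ### Boxes and the coordinate form of a transformation. -/

/-- `I × J × K × L × M` is a box of nonempty open intervals with `I` in the half-line `x > 0`. -/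
structure IsBox (I J K L M : Set ℝ) : Prop where
  openI : IsOpen I
  openJ : IsOpen J
  openK : IsOpen K
  openL : IsOpen L
  openM : IsOpen M
  connI : IsConnected I
  connJ : IsConnected J
  connK : IsConnected K
  connL : IsConnected L
  connM : IsConnected M
  pos : I ⊆ Ioi 0

/-- In coordinates, `Ψ` is `(X(x,t,u), T(x,t,u), U(x,t,u), g(γ), Φ)` with smooth `X, T, U` whose
differentials are jointly injective. -/
structure HasCoordinates (I J K L M : Set ℝ) (Ψ : ExtSpace → ExtSpace)
    (X T U : ℝ × ℝ × ℝ → ℝ) (g : ℝ → ℝ) : Prop where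
  eq : ∀ x ∈ I, ∀ t ∈ J, ∀ u ∈ K, ∀ γ ∈ L, ∀ f ∈ M,
    Ψ (x, t, u, γ, f) = (X (x, t, u), T (x, t, u), U (x, t, u), g γ, (Ψ (x, t, u, γ, f)).f)
  smoothX : ContDiffOn ℝ ∞ X (I ×ˢ J ×ˢ K)
  smoothT : ContDiffOn ℝ ∞ T (I ×ˢ J ×ˢ K)
  smoothU : ContDiffOn ℝ ∞ U (I ×ˢ J ×ˢ K)
  inj : ∀ y ∈ I ×ˢ J ×ˢ K, ∀ w, fderiv ℝ X y w = 0 → fderiv ℝ T y w = 0 →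
    fderiv ℝ U y w = 0 → w = 0

/-! ### Elementary tools. -/

theorem HasDerivAt.prod_fst {E F : Type*} [NormedAddCommGroup E] [NormedSpace ℝ E]
    [NormedAddCommGroup F] [NormedSpace ℝ F] {c : ℝ → E × F} {c' : E × F} {s : ℝ}
    (h : HasDerivAt c c' s) : HasDerivAt (fun s => (c s).1) c'.1 s :=
  (hasFDerivAt_fst (p := c s)).comp_hasDerivAt s h

theorem HasDerivAt.prod_snd {E F : Type*} [NormedAddCommGroup E] [NormedSpace ℝ E]
    [NormedAddCommGroup F] [NormedSpace ℝ F] {c : ℝ → E × F} {c' : E × F} {s : ℝ}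
    (h : HasDerivAt c c' s) : HasDerivAt (fun s => (c s).2) c'.2 s :=
  (hasFDerivAt_snd (p := c s)).comp_hasDerivAt s h

theorem exists_ne_ne_of_isOpen {s : Set ℝ} (hs : IsOpen s) (hne : s.Nonempty) (a b : ℝ) :
    ∃ c ∈ s, c ≠ a ∧ c ≠ b := by
  obtain ⟨x, hx⟩ := hne
  have hinf : s.Infinite := infinite_of_mem_nhds x (hs.mem_nhds hx)
  obtain ⟨c, hc, hc'⟩ := (hinf.sdiff (Set.toFinite {a, b})).nonempty
  simp only [mem_insert_iff, mem_singleton_iff, not_or] at hc'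
  exact ⟨c, hc, hc'.1, hc'.2⟩

/-- An affine function suffices. The purpose is to put two points of the extended space with the
same `γ` on the graph of a single pair of arbitrary elements. -/
theorem exists_smooth_interpolation {a b : ℝ × ℝ} (hab : a ≠ b) (m n : ℝ) :
    ∃ f : ℝ → ℝ → ℝ, ContDiff ℝ ∞ (Function.uncurry f) ∧ f a.1 a.2 = m ∧ f b.1 b.2 = n := by
  have hd : (b.1 - a.1) ^ 2 + (b.2 - a.2) ^ 2 ≠ 0 := by
    intro h
    apply hab
    have h1 : b.1 - a.1 = 0 := by nlinarith [sq_nonneg (b.1 - a.1), sq_nonneg (b.2 - a.2)]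
    have h2 : b.2 - a.2 = 0 := by nlinarith [sq_nonneg (b.1 - a.1), sq_nonneg (b.2 - a.2)]
    ext <;> linarith
  refine ⟨fun x u => m + (n - m) * (((x - a.1) * (b.1 - a.1) + (u - a.2) * (b.2 - a.2)) /
    ((b.1 - a.1) ^ 2 + (b.2 - a.2) ^ 2)), ?_, by simp, ?_⟩
  · unfold Function.uncurry
    fun_prop
  · have : ((b.1 - a.1) * (b.1 - a.1) + (b.2 - a.2) * (b.2 - a.2)) /
        ((b.1 - a.1) ^ 2 + (b.2 - a.2) ^ 2) = 1 := by
      rw [div_eq_one_iff_eq hd]; ring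
    simp only [this]; ring

namespace IsBox

variable {I J K L M : Set ℝ}

theorem isOpen_base (h : IsBox I J K L M) : IsOpen (I ×ˢ J ×ˢ K) :=
  h.openI.prod (h.openJ.prod h.openK)

theorem isOpen (h : IsBox I J K L M) : IsOpen (I ×ˢ J ×ˢ K ×ˢ L ×ˢ M) :=
  h.openI.prod (h.openJ.prod (h.openK.prod (h.openL.prod h.openM)))

end IsBox

/-! ### Dependence of the new variables on the old ones, from interpolation and injectivity. -/

namespace IsEquivalenceTransformation

variable {I J K L M : Set ℝ} {Ψ : ExtSpace → ExtSpace}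

theorem injOn {D : Set ExtSpace} (hΨ : IsEquivalenceTransformation D Ψ) : InjOn Ψ D := by
  obtain ⟨Θ, -, hΘ⟩ := hΨ.smooth_inverse
  exact hΘ.injOn

theorem fderiv_injective {D : Set ExtSpace} (hD : IsOpen D)
    (hΨ : IsEquivalenceTransformation D Ψ) {z : ExtSpace} (hz : z ∈ D) :
    Function.Injective (fderiv ℝ Ψ z) := by
  obtain ⟨Θ, hΘs, hΘ⟩ := hΨ.smooth_inverse
  have h1 : HasFDerivAt Ψ (fderiv ℝ Ψ z) z :=
    ((hΨ.smooth.contDiffAt (hD.mem_nhds hz)).differentiableAt (by simp)).hasFDerivAt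
  have h2 : HasFDerivAt Θ (fderiv ℝ Θ (Ψ z)) (Ψ z) :=
    ((hΘs.contDiffAt (hΨ.isOpen_image.mem_nhds ⟨z, hz, rfl⟩)).differentiableAt
      (by simp)).hasFDerivAt
  have h3 : HasFDerivAt (Θ ∘ Ψ) (ContinuousLinearMap.id ℝ ExtSpace) z :=
    (hasFDerivAt_id z).congr_of_eventuallyEq
      (Filter.eventuallyEq_of_mem (hD.mem_nhds hz) fun w hw => hΘ hw)
  have h4 := (h2.comp z h1).unique h3
  intro v w hvw
  have h5 : ∀ v, fderiv ℝ Θ (Ψ z) (fderiv ℝ Ψ z v) = v := fun v => by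
    simpa using congrArg (fun A => A v) h4
  rw [← h5 v, ← h5 w, hvw]

/-- The transformed `γ` does not depend on the variables other than `γ`. -/
theorem gamma_eq (hb : IsBox I J K L M)
    (hΨ : IsEquivalenceTransformation (I ×ˢ J ×ˢ K ×ˢ L ×ˢ M) Ψ) {z w : ExtSpace}
    (hz : z ∈ I ×ˢ J ×ˢ K ×ˢ L ×ˢ M) (hw : w ∈ I ×ˢ J ×ˢ K ×ˢ L ×ˢ M) (hzw : z.γ = w.γ) :
    (Ψ z).γ = (Ψ w).γ := by
  have key : ∀ z : ExtSpace, z ∈ I ×ˢ J ×ˢ K ×ˢ L ×ˢ M → ∀ w : ExtSpace,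
      w ∈ I ×ˢ J ×ˢ K ×ˢ L ×ˢ M → z.γ = w.γ →
      z.x ≠ w.x → (Ψ z).γ = (Ψ w).γ := by
    intro z hz w hw hγ hne
    obtain ⟨f, hf, h1, h2⟩ := exists_smooth_interpolation
      (a := (z.x, z.u)) (b := (w.x, w.u)) (fun h => hne (congrArg (fun a : ℝ × ℝ => a.1) h)) z.f w.f
    obtain ⟨γ', f', -, hel, -⟩ := hΨ.maps_class z.γ f univ isOpen_univ hf.contDiffOn
    rw [(hel z ⟨⟨trivial, rfl, h1.symm⟩, hz⟩).1, (hel w ⟨⟨trivial, hγ.symm, h2.symm⟩, hw⟩).1]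
  -- Interpolation needs different `(x, u)`; points sharing these are both compared with points over
  -- a third abscissa `c`.
  obtain ⟨c, hc, hcz, hcw⟩ := exists_ne_ne_of_isOpen hb.openI hb.connI.nonempty z.x w.x
  have hm : ((c, z.2) : ExtSpace) ∈ I ×ˢ J ×ˢ K ×ˢ L ×ˢ M := ⟨hc, hz.2⟩
  rw [key z hz (c, z.2) hm rfl (Ne.symm hcz), key w hw (c, z.2) hm hzw.symm (Ne.symm hcw)]

/-- The functions are obtained by freezing the remaining variables. For joint injectivity: the
differential of `Ψ` sends the `f`-direction to a nonzero multiple of itself, so a vector killed by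
`dX`, `dT`, `dU` would have an image proportional to that of the `f`-direction, against injectivity
of the differential. -/
theorem exists_coordinates (hb : IsBox I J K L M)
    (hΨ : IsEquivalenceTransformation (I ×ˢ J ×ˢ K ×ˢ L ×ˢ M) Ψ) :
    ∃ (X T U : ℝ × ℝ × ℝ → ℝ) (g : ℝ → ℝ), HasCoordinates I J K L M Ψ X T U g := by
  obtain ⟨x₀, hx₀⟩ := hb.connI.nonempty
  obtain ⟨t₀, ht₀⟩ := hb.connJ.nonempty
  obtain ⟨u₀, hu₀⟩ := hb.connK.nonempty
  obtain ⟨γ₀, hγ₀⟩ := hb.connL.nonempty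
  obtain ⟨f₀, hf₀⟩ := hb.connM.nonempty
  have hD := hb.isOpen
  set D : Set ExtSpace := I ×ˢ J ×ˢ K ×ˢ L ×ˢ M with hDdef
  set ι : ℝ × ℝ × ℝ → ExtSpace := fun y => (y.1, y.2.1, y.2.2, γ₀, f₀) with hι
  set κ : ℝ → ExtSpace := fun γ => (x₀, t₀, u₀, γ, f₀) with hκ
  have hιD : MapsTo ι (I ×ˢ J ×ˢ K) D := fun y hy => ⟨hy.1, hy.2.1, hy.2.2, hγ₀, hf₀⟩
  have hκD : MapsTo κ L D := fun γ hγ => ⟨hx₀, ht₀, hu₀, hγ, hf₀⟩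
  have hιs : ContDiff ℝ ∞ ι := by fun_prop
  have hκs : ContDiff ℝ ∞ κ := by fun_prop
  have hcomp := hΨ.smooth.comp hιs.contDiffOn hιD
  have heq : ∀ z ∈ D, (Ψ z).x = (Ψ (ι (z.x, z.t, z.u))).x ∧
      (Ψ z).t = (Ψ (ι (z.x, z.t, z.u))).t ∧ (Ψ z).u = (Ψ (ι (z.x, z.t, z.u))).u ∧
      (Ψ z).γ = (Ψ (κ z.γ)).γ := by
    intro z hz
    obtain ⟨h1, h2, h3⟩ := hΨ.projectable z hz (ι (z.x, z.t, z.u))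
      (hιD ⟨hz.1, hz.2.1, hz.2.2.1⟩) rfl rfl rfl
    exact ⟨h1, h2, h3, gamma_eq hb hΨ hz (hκD hz.2.2.2.1) rfl⟩
  refine ⟨fun y => (Ψ (ι y)).1, fun y => (Ψ (ι y)).2.1, fun y => (Ψ (ι y)).2.2.1,
    fun γ => (Ψ (κ γ)).2.2.2.1, ?_, hcomp.fst, hcomp.snd.fst, hcomp.snd.snd.fst, ?_⟩
  · intro x hx t ht u hu γ hγ f hf
    obtain ⟨h1, h2, h3, h4⟩ := heq (x, t, u, γ, f) ⟨hx, ht, hu, hγ, hf⟩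
    exact Prod.ext h1 (Prod.ext h2 (Prod.ext h3 (Prod.ext h4 rfl)))
  · intro y hy w h1 h2 h3
    have hz := hιD hy
    have hιw : HasFDerivAt ι (fderiv ℝ ι y) y :=
      (hιs.differentiable (by simp) y).hasFDerivAt
    have hιw' : ∀ w, fderiv ℝ ι y w = (w.1, w.2.1, w.2.2, 0, 0) := by
      intro w
      have : HasFDerivAt ι ((ContinuousLinearMap.fst ℝ ℝ (ℝ × ℝ)).prod
          (((ContinuousLinearMap.fst ℝ ℝ ℝ).comp (ContinuousLinearMap.snd ℝ ℝ (ℝ × ℝ))).prod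
          (((ContinuousLinearMap.snd ℝ ℝ ℝ).comp (ContinuousLinearMap.snd ℝ ℝ (ℝ × ℝ))).prod
          ((0 : ℝ × ℝ × ℝ →L[ℝ] ℝ).prod (0 : ℝ × ℝ × ℝ →L[ℝ] ℝ))))) y :=
        hasFDerivAt_fst.prodMk (hasFDerivAt_snd.fst.prodMk (hasFDerivAt_snd.snd.prodMk
          ((hasFDerivAt_const _ _).prodMk (hasFDerivAt_const _ _))))
      rw [this.fderiv]; rfl
    have hL : HasFDerivAt Ψ (fderiv ℝ Ψ (ι y)) (ι y) :=
      ((hΨ.smooth.contDiffAt (hD.mem_nhds hz)).differentiableAt (by simp)).hasFDerivAt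
    have hc := hL.comp y hιw
    have hX := hc.fst.fderiv
    have hT := hc.snd.fst.fderiv
    have hU := hc.snd.snd.fst.fderiv
    have hG := hc.snd.snd.snd.fst
    have hG0 : HasFDerivAt (fun y => ((Ψ ∘ ι) y).2.2.2.1) (0 : ℝ × ℝ × ℝ →L[ℝ] ℝ) y := by
      refine (hasFDerivAt_const ((Ψ (κ γ₀)).2.2.2.1) y).congr_of_eventuallyEq ?_
      exact Filter.eventuallyEq_of_mem (hb.isOpen_base.mem_nhds hy)
        fun w hw => (heq (ι w) (hιD hw)).2.2.2
    have hG' := hG.unique hG0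
    have e1 : (fderiv ℝ Ψ (ι y) (fderiv ℝ ι y w)).1 = 0 := by
      rw [← h1]; exact (congrArg (fun A => A w) hX).symm
    have e2 : (fderiv ℝ Ψ (ι y) (fderiv ℝ ι y w)).2.1 = 0 := by
      rw [← h2]; exact (congrArg (fun A => A w) hT).symm
    have e3 : (fderiv ℝ Ψ (ι y) (fderiv ℝ ι y w)).2.2.1 = 0 := by
      rw [← h3]; exact (congrArg (fun A => A w) hU).symm
    have e4 : (fderiv ℝ Ψ (ι y) (fderiv ℝ ι y w)).2.2.2.1 = 0 := congrArg (fun A => A w) hG'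
    -- Along this curve only `f` varies, so all components of the image except the last are
    -- constant.
    set φ : ℝ → ExtSpace := fun f => (y.1, y.2.1, y.2.2, γ₀, f) with hφ
    have hφd : HasDerivAt φ (0, 0, 0, 0, 1) f₀ :=
      (hasDerivAt_const _ _).prodMk ((hasDerivAt_const _ _).prodMk
        ((hasDerivAt_const _ _).prodMk ((hasDerivAt_const _ _).prodMk (hasDerivAt_id _))))
    have hcφ : HasDerivAt (Ψ ∘ φ) (fderiv ℝ Ψ (ι y) (0, 0, 0, 0, 1)) f₀ :=
      HasFDerivAt.comp_hasDerivAt f₀ hL hφd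
    have hfix : ∀ᶠ f in nhds f₀, φ f ∈ D := by
      filter_upwards [hb.openM.mem_nhds hf₀] with f hf
      exact ⟨hy.1, hy.2.1, hy.2.2, hγ₀, hf⟩
    have a1 : (fderiv ℝ Ψ (ι y) (0, 0, 0, 0, 1)).1 = 0 :=
      hcφ.prod_fst.unique ((hasDerivAt_const f₀ (Ψ (ι y)).1).congr_of_eventuallyEq
        (hfix.mono fun f hf => (heq _ hf).1))
    have a2 : (fderiv ℝ Ψ (ι y) (0, 0, 0, 0, 1)).2.1 = 0 :=
      hcφ.prod_snd.prod_fst.unique ((hasDerivAt_const f₀ (Ψ (ι y)).2.1).congr_of_eventuallyEq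
        (hfix.mono fun f hf => (heq _ hf).2.1))
    have a3 : (fderiv ℝ Ψ (ι y) (0, 0, 0, 0, 1)).2.2.1 = 0 :=
      hcφ.prod_snd.prod_snd.prod_fst.unique ((hasDerivAt_const f₀ (Ψ (ι y)).2.2.1).congr_of_eventuallyEq
        (hfix.mono fun f hf => (heq _ hf).2.2.1))
    have a4 : (fderiv ℝ Ψ (ι y) (0, 0, 0, 0, 1)).2.2.2.1 = 0 :=
      hcφ.prod_snd.prod_snd.prod_snd.prod_fst.unique ((hasDerivAt_const f₀ (Ψ (κ γ₀)).2.2.2.1).congr_of_eventuallyEq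
        (hfix.mono fun f hf => (heq _ hf).2.2.2))
    set A := fderiv ℝ Ψ (ι y) with hA
    set v := fderiv ℝ ι y w with hv
    have hinj : Function.Injective A := fderiv_injective hD hΨ hz
    have hb0 : (A (0, 0, 0, 0, 1)).2.2.2.2 ≠ 0 := by
      intro h0
      have h00 : A (0, 0, 0, 0, 1) = A 0 := by
        rw [map_zero]
        exact Prod.ext a1 (Prod.ext a2 (Prod.ext a3 (Prod.ext a4 h0)))
      have := congrArg (fun z : ExtSpace => z.2.2.2.2) (hinj h00)
      simp at this
    have hcomb : A ((A (0, 0, 0, 0, 1)).2.2.2.2 • v) =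
        A ((A v).2.2.2.2 • (0, 0, 0, 0, 1)) := by
      rw [map_smul, map_smul]
      refine Prod.ext ?_ (Prod.ext ?_ (Prod.ext ?_ (Prod.ext ?_ ?_))) <;>
        simp only [Prod.smul_fst, Prod.smul_snd, e1, e2, e3, e4, a1, a2, a3, a4, smul_eq_mul,
          mul_zero]
      ring
    have hvv := hinj hcomb
    rw [hv, hιw'] at hvv
    have q1 := congrArg (fun z : ExtSpace => z.1) hvv
    have q2 := congrArg (fun z : ExtSpace => z.2.1) hvv
    have q3 := congrArg (fun z : ExtSpace => z.2.2.1) hvv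
    simp only [Prod.smul_fst, Prod.smul_snd, smul_eq_mul, mul_zero, mul_eq_zero, hb0,
      false_or] at q1 q2 q3
    exact Prod.ext q1 (Prod.ext q2 q3)

/-- Points with the same transformed `x` and `u` have the same `x` and `u`. -/
theorem fiber (hb : IsBox I J K L M)
    (hΨ : IsEquivalenceTransformation (I ×ˢ J ×ˢ K ×ˢ L ×ˢ M) Ψ) {X T U : ℝ × ℝ × ℝ → ℝ}
    {g : ℝ → ℝ} (hc : HasCoordinates I J K L M Ψ X T U g) {y w : ℝ × ℝ × ℝ}
    (hy : y ∈ I ×ˢ J ×ˢ K) (hw : w ∈ I ×ˢ J ×ˢ K) (hX : X y = X w) (hU : U y = U w) :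
    (y.1, y.2.2) = (w.1, w.2.2) := by
  -- If `(x, u)` differed, one element could take the value `m₀` at `y` and any `m` at `w`. The
  -- images share their new `x` and `u`, hence their new `f`, so the new `f` at `w` would not depend
  -- on `m`, contradicting injectivity.
  by_contra hne
  obtain ⟨γ₀, hγ₀⟩ := hb.connL.nonempty
  obtain ⟨m₀, hm₀⟩ := hb.connM.nonempty
  obtain ⟨m₁, hm₁, hm, -⟩ := exists_ne_ne_of_isOpen hb.openM hb.connM.nonempty m₀ m₀
  have key : ∀ m ∈ M, (Ψ (y.1, y.2.1, y.2.2, γ₀, m₀)).f = (Ψ (w.1, w.2.1, w.2.2, γ₀, m)).f := by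
    intro m hm
    obtain ⟨f, hf, h1, h2⟩ := exists_smooth_interpolation hne m₀ m
    obtain ⟨γ', f', -, hel, -⟩ := hΨ.maps_class γ₀ f univ isOpen_univ hf.contDiffOn
    have e1 := (hel (y.1, y.2.1, y.2.2, γ₀, m₀)
      ⟨⟨trivial, rfl, h1.symm⟩, hy.1, hy.2.1, hy.2.2, hγ₀, hm₀⟩).2
    have e2 := (hel (w.1, w.2.1, w.2.2, γ₀, m)
      ⟨⟨trivial, rfl, h2.symm⟩, hw.1, hw.2.1, hw.2.2, hγ₀, hm⟩).2
    rw [e1, e2, hc.eq _ hy.1 _ hy.2.1 _ hy.2.2 _ hγ₀ _ hm₀,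
      hc.eq _ hw.1 _ hw.2.1 _ hw.2.2 _ hγ₀ _ hm]
    exact congrArg₂ f' hX hU
  have h := (key m₀ hm₀).symm.trans (key m₁ hm₁)
  have h2 : Ψ (w.1, w.2.1, w.2.2, γ₀, m₀) = Ψ (w.1, w.2.1, w.2.2, γ₀, m₁) := by
    rw [hc.eq _ hw.1 _ hw.2.1 _ hw.2.2 _ hγ₀ _ hm₀,
      hc.eq _ hw.1 _ hw.2.1 _ hw.2.2 _ hγ₀ _ hm₁, h]
  have h3 := injOn hΨ (show ((w.1, w.2.1, w.2.2, γ₀, m₀) : ExtSpace) ∈ _ from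
    ⟨hw.1, hw.2.1, hw.2.2, hγ₀, hm₀⟩) ⟨hw.1, hw.2.1, hw.2.2, hγ₀, hm₁⟩ h2
  exact hm (congrArg (fun z : ExtSpace => z.2.2.2.2) h3).symm

/-- `X` and `U` do not depend on `t`, while `T` does. -/
theorem fderiv_t (hb : IsBox I J K L M)
    (hΨ : IsEquivalenceTransformation (I ×ˢ J ×ˢ K ×ˢ L ×ˢ M) Ψ) {X T U : ℝ × ℝ × ℝ → ℝ}
    {g : ℝ → ℝ} (hc : HasCoordinates I J K L M Ψ X T U g) {y : ℝ × ℝ × ℝ}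
    (hy : y ∈ I ×ˢ J ×ˢ K) :
    fderiv ℝ X y (0, 1, 0) = 0 ∧ fderiv ℝ U y (0, 1, 0) = 0 ∧ fderiv ℝ T y (0, 1, 0) ≠ 0 := by
  obtain ⟨γ₀, hγ₀⟩ := hb.connL.nonempty
  obtain ⟨f₀, hf₀⟩ := hb.connM.nonempty
  obtain ⟨Θ, hΘs, hΘ⟩ := hΨ.smooth_inverse
  set z₀ : ExtSpace := (y.1, y.2.1, y.2.2, γ₀, f₀) with hz₀
  have hz : z₀ ∈ I ×ˢ J ×ˢ K ×ˢ L ×ˢ M := ⟨hy.1, hy.2.1, hy.2.2, hγ₀, hf₀⟩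
  -- A straight line in the new `t`-direction is pulled back by the inverse. The new `x` and `u` are
  -- constant on it, so by `fiber` the old `x` and `u` are constant too.
  set l : ℝ → ExtSpace := fun s => Ψ z₀ + s • (0, 1, 0, 0, 0) with hl
  have hl0 : l 0 = Ψ z₀ := by simp [hl]
  have hld : HasDerivAt l (0, 1, 0, 0, 0) 0 := by
    have := ((hasDerivAt_id (0 : ℝ)).smul_const ((0, 1, 0, 0, 0) : ExtSpace)).const_add (Ψ z₀)
    rwa [one_smul] at this
  have hΘd : HasFDerivAt Θ (fderiv ℝ Θ (Ψ z₀)) (l 0) := by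
    rw [hl0]
    exact ((hΘs.contDiffAt (hΨ.isOpen_image.mem_nhds ⟨z₀, hz, rfl⟩)).differentiableAt
      (by simp)).hasFDerivAt
  have hcd := hΘd.comp_hasDerivAt (0 : ℝ) hld
  set k := fderiv ℝ Θ (Ψ z₀) (0, 1, 0, 0, 0) with hk
  have hev : ∀ᶠ s in nhds (0 : ℝ), l s ∈ Ψ '' (I ×ˢ J ×ˢ K ×ˢ L ×ˢ M) := by
    refine hld.continuousAt.eventually_mem ?_
    rw [hl0]
    exact hΨ.isOpen_image.mem_nhds ⟨z₀, hz, rfl⟩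
  have hev2 : ∀ᶠ s in nhds (0 : ℝ), Θ (l s) ∈ I ×ˢ J ×ˢ K ×ˢ L ×ˢ M ∧ Ψ (Θ (l s)) = l s := by
    filter_upwards [hev] with s hs
    obtain ⟨w, hw, hws⟩ := hs
    rw [← hws, hΘ hw]
    exact ⟨hw, rfl⟩
  have hcoord : ∀ z ∈ I ×ˢ J ×ˢ K ×ˢ L ×ˢ M, (Ψ z).1 = X (z.1, z.2.1, z.2.2.1) ∧
      (Ψ z).2.1 = T (z.1, z.2.1, z.2.2.1) ∧ (Ψ z).2.2.1 = U (z.1, z.2.1, z.2.2.1) := by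
    intro z hz
    have := hc.eq _ hz.1 _ hz.2.1 _ hz.2.2.1 _ hz.2.2.2.1 _ hz.2.2.2.2
    exact ⟨congrArg (fun z : ExtSpace => z.1) this, congrArg (fun z : ExtSpace => z.2.1) this,
      congrArg (fun z : ExtSpace => z.2.2.1) this⟩
  have hconst : ∀ᶠ s in nhds (0 : ℝ), (Θ (l s)).1 = y.1 ∧ (Θ (l s)).2.2.1 = y.2.2 := by
    filter_upwards [hev2] with s hs
    obtain ⟨hm, he⟩ := hs
    have hfib := fiber hb hΨ hc (y := ((Θ (l s)).1, (Θ (l s)).2.1, (Θ (l s)).2.2.1)) (w := y)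
      ⟨hm.1, hm.2.1, hm.2.2.1⟩ hy
      (by rw [← (hcoord _ hm).1, he]; simpa [hl] using (hcoord _ hz).1)
      (by rw [← (hcoord _ hm).2.2, he]; simpa [hl] using (hcoord _ hz).2.2)
    exact ⟨congrArg Prod.fst hfib, congrArg Prod.snd hfib⟩
  have hk1 : k.1 = 0 := hcd.prod_fst.unique
    ((hasDerivAt_const (0 : ℝ) y.1).congr_of_eventuallyEq (hconst.mono fun s hs => hs.1))
  have hk3 : k.2.2.1 = 0 := hcd.prod_snd.prod_snd.prod_fst.unique
    ((hasDerivAt_const (0 : ℝ) y.2.2).congr_of_eventuallyEq (hconst.mono fun s hs => hs.2))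
  have hΘ0 : Θ (l 0) = z₀ := by rw [hl0]; exact hΘ hz
  -- The `γ`- and `f`-components of `k` are not controlled, so the curve is projected to `(x, t,
  -- u)`, the only variables of `X`, `T`, `U`.
  set π : ℝ → ℝ × ℝ × ℝ := fun s => ((Θ (l s)).1, (Θ (l s)).2.1, (Θ (l s)).2.2.1) with hπ
  have hπ0 : π 0 = y := by simp only [hπ, hΘ0, hz₀]
  have hπd : HasDerivAt π (0, k.2.1, 0) 0 := by
    have := hcd.prod_fst.prodMk (hcd.prod_snd.prod_fst.prodMk hcd.prod_snd.prod_snd.prod_fst)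
    rwa [hk1, hk3] at this
  have hdiff : ∀ {Y : ℝ × ℝ × ℝ → ℝ}, ContDiffOn ℝ ∞ Y (I ×ˢ J ×ˢ K) →
      HasDerivAt (Y ∘ π) (fderiv ℝ Y y (0, k.2.1, 0)) 0 := by
    intro Y hY
    refine HasFDerivAt.comp_hasDerivAt (0 : ℝ) ?_ hπd
    rw [hπ0]
    exact ((hY.contDiffAt (hb.isOpen_base.mem_nhds hy)).differentiableAt (by simp)).hasFDerivAt
  have hXk : fderiv ℝ X y (0, k.2.1, 0) = 0 :=
    (hdiff hc.smoothX).unique ((hasDerivAt_const (0 : ℝ) (Ψ z₀).1).congr_of_eventuallyEq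
      (hev2.mono fun s hs => by
        have := (hcoord _ hs.1).1
        rw [hs.2] at this
        simpa [hl, hπ] using this.symm))
  have hUk : fderiv ℝ U y (0, k.2.1, 0) = 0 :=
    (hdiff hc.smoothU).unique ((hasDerivAt_const (0 : ℝ) (Ψ z₀).2.2.1).congr_of_eventuallyEq
      (hev2.mono fun s hs => by
        have := (hcoord _ hs.1).2.2
        rw [hs.2] at this
        simpa [hl, hπ] using this.symm))
  have hTk : fderiv ℝ T y (0, k.2.1, 0) = 1 :=
    (hdiff hc.smoothT).unique (((hasDerivAt_id (0 : ℝ)).const_add (Ψ z₀).2.1).congr_of_eventuallyEq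
      (hev2.mono fun s hs => by
        have := (hcoord _ hs.1).2.1
        rw [hs.2] at this
        simpa [hl, hπ] using this.symm))
  have hsm : ((0, k.2.1, 0) : ℝ × ℝ × ℝ) = k.2.1 • (0, 1, 0) := by simp
  rw [hsm, map_smul, smul_eq_mul] at hXk hUk hTk
  have hk2 : k.2.1 ≠ 0 := fun h => by simp [h] at hTk
  refine ⟨?_, ?_, fun h => by simp [h] at hTk⟩
  · simpa [hk2] using hXk
  · simpa [hk2] using hUk

end IsEquivalenceTransformation

/-! ### Derivatives along curves, and test solutions. -/

theorem iteratedDeriv_two (f : ℝ → ℝ) : iteratedDeriv 2 f = deriv (deriv f) := by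
  rw [iteratedDeriv_succ, iteratedDeriv_one]

theorem two_le_infty : (2 : WithTop ℕ∞) ≤ ∞ :=
  WithTop.coe_le_coe.2 (le_top : (2 : ℕ∞) ≤ ⊤)

theorem ContDiffAt.deriv_infty {E : Type*} [NormedAddCommGroup E] [NormedSpace ℝ E]
    {c : ℝ → E} {s : ℝ} (hc : ContDiffAt ℝ ∞ c s) : ContDiffAt ℝ ∞ (deriv c) s := by
  have h : ContDiffAt ℝ ∞ (fun x => fderiv ℝ c x 1) s :=
    (hc.fderiv_right (m := ∞) (by simp)).clm_apply contDiffAt_const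
  exact h

theorem deriv_comp_curve {E : Type*} [NormedAddCommGroup E] [NormedSpace ℝ E] {Y : E → ℝ}
    {c : ℝ → E} {s : ℝ} (hY : ContDiffAt ℝ ∞ Y (c s)) (hc : ContDiffAt ℝ ∞ c s) :
    deriv (fun s => Y (c s)) s = fderiv ℝ Y (c s) (deriv c s) :=
  ((hY.differentiableAt (by simp)).hasFDerivAt.comp_hasDerivAt s
    (hc.differentiableAt (by simp)).hasDerivAt).deriv

theorem second_deriv_comp_curve {E : Type*} [NormedAddCommGroup E] [NormedSpace ℝ E] {Y : E → ℝ}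
    {c : ℝ → E} {s : ℝ} (hY : ContDiffAt ℝ ∞ Y (c s)) (hc : ContDiffAt ℝ ∞ c s) :
    deriv (deriv (fun s => Y (c s))) s =
      fderiv ℝ (fderiv ℝ Y) (c s) (deriv c s) (deriv c s) +
        fderiv ℝ Y (c s) (deriv (deriv c) s) := by
  have hY2 : ContDiffAt ℝ 2 Y (c s) := hY.of_le two_le_infty
  have hc2 : ContDiffAt ℝ 2 c s := hc.of_le two_le_infty
  have hev : deriv (fun s => Y (c s)) =ᶠ[nhds s] fun s => fderiv ℝ Y (c s) (deriv c s) := by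
    filter_upwards [hc2.eventually (by simp),
      hc.continuousAt.eventually (hY2.eventually (by simp))] with s h1 h2
    exact ((h2.differentiableAt (by simp)).hasFDerivAt.comp_hasDerivAt s
      (h1.differentiableAt (by simp)).hasDerivAt).deriv
  rw [hev.deriv_eq]
  have h1 : HasFDerivAt (fderiv ℝ Y) (fderiv ℝ (fderiv ℝ Y) (c s)) (c s) :=
    ((hY2.fderiv_right (m := 1) (by norm_num)).differentiableAt (by simp)).hasFDerivAt
  have h2 : HasDerivAt c (deriv c s) s := (hc2.differentiableAt (by simp)).hasDerivAt
  have h3 : HasDerivAt (deriv c) (deriv (deriv c) s) s :=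
    (hc.deriv_infty.differentiableAt (by simp)).hasDerivAt
  exact ((h1.comp_hasDerivAt s h2).clm_apply h3).deriv

/-- A function with prescribed jet at `(x₀, t₀)`. -/
noncomputable def testFun (x₀ t₀ u₀ p q r k x t : ℝ) : ℝ :=
  u₀ + p * (x - x₀) + r / 2 * (x - x₀) ^ 2 + q / k * (Real.exp (k * (t - t₀)) - 1)

/-- An arbitrary element of the class for which `testFun` is a solution. -/
noncomputable def testElement (x₀ u₀ p q r k γ x w : ℝ) : ℝ :=
  q + k * (w - (u₀ + p * (x - x₀) + r / 2 * (x - x₀) ^ 2)) + x ^ (2 * γ) * r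

theorem contDiff_testFun (x₀ t₀ u₀ p q r k : ℝ) :
    ContDiff ℝ ∞ (Function.uncurry (testFun x₀ t₀ u₀ p q r k)) := by
  unfold testFun Function.uncurry
  fun_prop

theorem contDiffOn_testElement (x₀ u₀ p q r k γ : ℝ) :
    ContDiffOn ℝ ∞ (Function.uncurry (testElement x₀ u₀ p q r k γ)) (Ioi 0 ×ˢ univ) := by
  have h : ContDiffOn ℝ ∞ (fun z : ℝ × ℝ => z.1 ^ (2 * γ)) (Ioi 0 ×ˢ univ) := fun z hz =>
    (contDiffAt_fst.rpow_const_of_ne (ne_of_gt hz.1)).contDiffWithinAt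
  have h2 : ContDiff ℝ ∞ (fun z : ℝ × ℝ =>
    q + k * (z.2 - (u₀ + p * (z.1 - x₀) + r / 2 * (z.1 - x₀) ^ 2))) := by fun_prop
  exact h2.contDiffOn.add (h.mul contDiffOn_const)

theorem hasDerivAt_testFun (x₀ t₀ u₀ p q r : ℝ) {k : ℝ} (hk : k ≠ 0) {ξ τ : ℝ → ℝ} {a b s : ℝ}
    (hξ : HasDerivAt ξ a s) (hτ : HasDerivAt τ b s) :
    HasDerivAt (fun s => testFun x₀ t₀ u₀ p q r k (ξ s) (τ s))
      ((p + r * (ξ s - x₀)) * a + q * Real.exp (k * (τ s - t₀)) * b) s := by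
  unfold testFun
  have h1 := hξ.sub_const x₀
  have h2 := (((hτ.sub_const t₀).const_mul k).exp.sub_const 1).const_mul (q / k)
  refine ((((h1.const_mul p).const_add u₀).add ((h1.pow 2).const_mul (r / 2))).add h2).congr_deriv ?_
  field_simp
  simp
  ring

/-- Both arguments move along curves because, after the change of variables, the old `x` and `t` are
functions of the new `x`. -/
theorem second_deriv_testFun (x₀ t₀ u₀ p q r : ℝ) {k : ℝ} (hk : k ≠ 0) {ξ τ : ℝ → ℝ} {s : ℝ}
    (hξ : ContDiffAt ℝ ∞ ξ s) (hτ : ContDiffAt ℝ ∞ τ s) :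
    deriv (deriv (fun s => testFun x₀ t₀ u₀ p q r k (ξ s) (τ s))) s =
      r * deriv ξ s ^ 2 + (p + r * (ξ s - x₀)) * deriv (deriv ξ) s +
      q * Real.exp (k * (τ s - t₀)) * (k * deriv τ s ^ 2 + deriv (deriv τ) s) := by
  have hξ2 : ContDiffAt ℝ 2 ξ s := hξ.of_le two_le_infty
  have hτ2 : ContDiffAt ℝ 2 τ s := hτ.of_le two_le_infty
  have hev : deriv (fun s => testFun x₀ t₀ u₀ p q r k (ξ s) (τ s)) =ᶠ[nhds s] fun s =>
      (p + r * (ξ s - x₀)) * deriv ξ s + q * Real.exp (k * (τ s - t₀)) * deriv τ s := by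
    filter_upwards [hξ2.eventually (by simp), hτ2.eventually (by simp)] with s h1 h2
    exact (hasDerivAt_testFun x₀ t₀ u₀ p q r hk (h1.differentiableAt (by simp)).hasDerivAt
      (h2.differentiableAt (by simp)).hasDerivAt).deriv
  rw [hev.deriv_eq]
  have d1 := (hξ.differentiableAt (by simp)).hasDerivAt
  have d2 := (hτ.differentiableAt (by simp)).hasDerivAt
  have d1' : HasDerivAt (deriv ξ) (deriv (deriv ξ) s) s :=
    (hξ.deriv_infty.differentiableAt (by simp)).hasDerivAt
  have d2' : HasDerivAt (deriv τ) (deriv (deriv τ) s) s :=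
    (hτ.deriv_infty.differentiableAt (by simp)).hasDerivAt
  refine ((((((d1.sub_const x₀).const_mul r).const_add p).mul d1').add
    ((((d2.sub_const t₀).const_mul k).exp.const_mul q).mul d2')).congr_deriv ?_).deriv
  ring

/-- The exponential profile makes `u_t` a function of `(x, u)`: it equals `q` plus `k` times the
difference of `u` and the quadratic part. At the base point the element does not see `p` and `k`,
which therefore remain free. -/
theorem isSolutionOn_testFun (x₀ t₀ u₀ p q r γ : ℝ) {k : ℝ} (hk : k ≠ 0) (W : Set (ℝ × ℝ)) :
    IsSolutionOn γ (testElement x₀ u₀ p q r k γ) W (testFun x₀ t₀ u₀ p q r k) := by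
  refine ⟨(contDiff_testFun x₀ t₀ u₀ p q r k).contDiffOn, fun x t _ => ?_⟩
  have h1 := (hasDerivAt_testFun x₀ t₀ u₀ p q r hk (hasDerivAt_const t x) (hasDerivAt_id t)).deriv
  have h2 := second_deriv_testFun x₀ t₀ u₀ p q r hk (ξ := id) (τ := fun _ => t) (s := x)
    contDiffAt_id contDiffAt_const
  simp only [id, mul_zero, zero_add, mul_one] at h1
  simp only [id, deriv_const', one_pow, mul_one, mul_zero, add_zero,
    zero_pow (two_ne_zero), deriv_id'] at h2
  rw [h1, iteratedDeriv_two, h2]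
  unfold testElement testFun
  field_simp
  ring

/-! ### The transformed equation on jets. -/

/-- The jets of test solutions at `y` are mapped to jets satisfying the transformed equation. -/
theorem jet_identity {I J K L M : Set ℝ} {Ψ : ExtSpace → ExtSpace} (hb : IsBox I J K L M)
    (hΨ : IsEquivalenceTransformation (I ×ˢ J ×ˢ K ×ˢ L ×ˢ M) Ψ) {X T U : ℝ × ℝ × ℝ → ℝ}
    {g : ℝ → ℝ} (hc : HasCoordinates I J K L M Ψ X T U g) {x₀ t₀ u₀ : ℝ}
    (hy : (x₀, t₀, u₀) ∈ I ×ˢ J ×ˢ K) {γ : ℝ} (hγ : γ ∈ L) {p q r k : ℝ} (hk : k ≠ 0)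
    (hM : q + x₀ ^ (2 * γ) * r ∈ M)
    (hnd : ∀ a b : ℝ, fderiv ℝ X (x₀, t₀, u₀) (a, b, p * a + q * b) = 0 →
      fderiv ℝ T (x₀, t₀, u₀) (a, b, p * a + q * b) = 0 → a = 0 ∧ b = 0) :
    ∃ ξ τ ξ₂ τ₂ e₁ e₂ : ℝ,
      fderiv ℝ X (x₀, t₀, u₀) (ξ, τ, p * ξ + q * τ) = 1 ∧
      fderiv ℝ T (x₀, t₀, u₀) (ξ, τ, p * ξ + q * τ) = 0 ∧
      fderiv ℝ X (x₀, t₀, u₀) (e₁, e₂, p * e₁ + q * e₂) = 0 ∧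
      fderiv ℝ T (x₀, t₀, u₀) (e₁, e₂, p * e₁ + q * e₂) = 1 ∧
      fderiv ℝ (fderiv ℝ X) (x₀, t₀, u₀) (ξ, τ, p * ξ + q * τ) (ξ, τ, p * ξ + q * τ) +
        fderiv ℝ X (x₀, t₀, u₀)
          (ξ₂, τ₂, p * ξ₂ + q * τ₂ + r * ξ ^ 2 + k * q * τ ^ 2) = 0 ∧
      fderiv ℝ (fderiv ℝ T) (x₀, t₀, u₀) (ξ, τ, p * ξ + q * τ) (ξ, τ, p * ξ + q * τ) +
        fderiv ℝ T (x₀, t₀, u₀)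
          (ξ₂, τ₂, p * ξ₂ + q * τ₂ + r * ξ ^ 2 + k * q * τ ^ 2) = 0 ∧
      fderiv ℝ U (x₀, t₀, u₀) (e₁, e₂, p * e₁ + q * e₂) + X (x₀, t₀, u₀) ^ (2 * g γ) *
        (fderiv ℝ (fderiv ℝ U) (x₀, t₀, u₀) (ξ, τ, p * ξ + q * τ) (ξ, τ, p * ξ + q * τ) +
        fderiv ℝ U (x₀, t₀, u₀)
          (ξ₂, τ₂, p * ξ₂ + q * τ₂ + r * ξ ^ 2 + k * q * τ ^ 2)) =
      (Ψ (x₀, t₀, u₀, γ, q + x₀ ^ (2 * γ) * r)).f := by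
  set y₀ : ℝ × ℝ × ℝ := (x₀, t₀, u₀) with hy₀
  set u := testFun x₀ t₀ u₀ p q r k with hu
  set f := testElement x₀ u₀ p q r k γ with hf
  have hus : ContDiff ℝ ∞ (fun a : ℝ × ℝ => u a.1 a.2) := contDiff_testFun x₀ t₀ u₀ p q r k
  have hu₀ : u x₀ t₀ = u₀ := by simp [hu, testFun]
  have hf₀ : f x₀ u₀ = q + x₀ ^ (2 * γ) * r := by simp [hf, testElement]
  have hfs := contDiffOn_testElement x₀ u₀ p q r k γ
  rw [← hf] at hfs
  set B := I ×ˢ J ×ˢ K with hB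
  have hBo : IsOpen B := hb.isOpen_base
  set Y : ℝ × ℝ → ℝ × ℝ × ℝ := fun a => (a.1, a.2, u a.1 a.2) with hY
  have hYs : ContDiff ℝ ∞ Y := contDiff_fst.prodMk (contDiff_snd.prodMk hus)
  have hY₀ : Y (x₀, t₀) = y₀ := by simp [hY, hy₀, hu₀]
  set S : ℝ × ℝ → ℝ × ℝ := fun a => (X (Y a), T (Y a)) with hS
  have hO₁ : IsOpen (Y ⁻¹' B) := hBo.preimage hYs.continuous
  have hfc : ContinuousOn (fun a : ℝ × ℝ => f a.1 (u a.1 a.2)) (Y ⁻¹' B) :=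
    hfs.continuousOn.comp (contDiff_fst.prodMk hus).continuous.continuousOn
      fun a ha => ⟨hb.pos ha.1, trivial⟩
  -- Over `O` the lifted graph of `u` stays inside the box.
  set O : Set (ℝ × ℝ) := Y ⁻¹' B ∩ (fun a : ℝ × ℝ => f a.1 (u a.1 a.2)) ⁻¹' M with hO
  have hOo : IsOpen O := hfc.isOpen_inter_preimage hO₁ hb.openM
  have hO₀ : (x₀, t₀) ∈ O := by
    refine ⟨?_, ?_⟩
    · rw [mem_preimage, hY₀]; exact hy
    · rw [mem_preimage, hu₀, hf₀]; exact hM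
  have hXs : ContDiffOn ℝ ∞ (fun a => X (Y a)) O :=
    hc.smoothX.comp hYs.contDiffOn fun a ha => ha.1
  have hTs : ContDiffOn ℝ ∞ (fun a => T (Y a)) O :=
    hc.smoothT.comp hYs.contDiffOn fun a ha => ha.1
  have hUs : ContDiffOn ℝ ∞ (fun a => U (Y a)) O :=
    hc.smoothU.comp hYs.contDiffOn fun a ha => ha.1
  have hSs : ContDiffOn ℝ ∞ S O := hXs.prodMk hTs
  have hdat : ∀ {Z : ℝ × ℝ × ℝ → ℝ}, ContDiffOn ℝ ∞ Z B → ContDiffAt ℝ ∞ Z y₀ :=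
    fun hZ => hZ.contDiffAt (hBo.mem_nhds hy)
  -- the differential of `S` at the base point
  have hdS : ∀ a b : ℝ, fderiv ℝ S (x₀, t₀) (a, b) =
      (fderiv ℝ X y₀ (a, b, p * a + q * b), fderiv ℝ T y₀ (a, b, p * a + q * b)) := by
    intro a b
    have hl1 : HasDerivAt (fun s : ℝ => x₀ + s * a) a 0 := by
      simpa using ((hasDerivAt_id (0 : ℝ)).mul_const a).const_add x₀
    have hl2 : HasDerivAt (fun s : ℝ => t₀ + s * b) b 0 := by
      simpa using ((hasDerivAt_id (0 : ℝ)).mul_const b).const_add t₀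
    have hl : HasDerivAt (fun s : ℝ => (x₀ + s * a, t₀ + s * b)) (a, b) 0 := hl1.prodMk hl2
    have hl3 := hasDerivAt_testFun x₀ t₀ u₀ p q r hk hl1 hl2
    have hYl : HasDerivAt (fun s : ℝ => Y (x₀ + s * a, t₀ + s * b)) (a, b, p * a + q * b) 0 := by
      refine hl1.prodMk (hl2.prodMk (hl3.congr_deriv ?_))
      simp
    have hSd : HasFDerivAt S (fderiv ℝ S (x₀, t₀)) (x₀ + 0 * a, t₀ + 0 * b) := by
      simpa using ((hSs.contDiffAt (hOo.mem_nhds hO₀)).differentiableAt (by simp)).hasFDerivAt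
    have h1 := hSd.comp_hasDerivAt (0 : ℝ) hl
    have hZ : ∀ {Z : ℝ × ℝ × ℝ → ℝ}, ContDiffOn ℝ ∞ Z B →
        HasDerivAt (fun s : ℝ => Z (Y (x₀ + s * a, t₀ + s * b)))
          (fderiv ℝ Z y₀ (a, b, p * a + q * b)) 0 := by
      intro Z hZ
      refine HasFDerivAt.comp_hasDerivAt (0 : ℝ) ?_ hYl
      simpa [hY₀] using ((hdat hZ).differentiableAt (by simp)).hasFDerivAt
    exact h1.unique ((hZ hc.smoothX).prodMk (hZ hc.smoothT))
  have hunit₀ : IsUnit (fderiv ℝ S (x₀, t₀)) := by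
    have hinj : Function.Injective (fderiv ℝ S (x₀, t₀)) := by
      rw [injective_iff_map_eq_zero]
      rintro ⟨a, b⟩ hab
      rw [hdS, Prod.mk_eq_zero] at hab
      obtain ⟨h1, h2⟩ := hnd a b hab.1 hab.2
      rw [h1, h2]; rfl
    rw [ContinuousLinearMap.isUnit_iff_bijective]
    exact ⟨hinj, (LinearMap.injective_iff_surjective
      (f := (fderiv ℝ S (x₀, t₀) : (ℝ × ℝ) →ₗ[ℝ] ℝ × ℝ))).1 hinj⟩
  -- Invertibility of `dS` is imposed on a whole open set, so that the local inverse is smooth on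
  -- all of its domain and the transformed function is admissible in `maps_class`.
  set O' : Set (ℝ × ℝ) := O ∩ fderiv ℝ S ⁻¹' {A | IsUnit A} with hO'
  have hO'o : IsOpen O' :=
    (hSs.continuousOn_fderiv_of_isOpen hOo (by simp)).isOpen_inter_preimage hOo Units.isOpen
  have hunit : ∀ a ∈ O', ∃ A : (ℝ × ℝ) ≃L[ℝ] ℝ × ℝ,
      HasFDerivAt S (A : (ℝ × ℝ) →L[ℝ] ℝ × ℝ) a := by
    rintro a ⟨ha, A, hA⟩
    refine ⟨ContinuousLinearEquiv.ofUnit A, ?_⟩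
    have h1 := ((hSs.contDiffAt (hOo.mem_nhds ha)).differentiableAt (by simp)).hasFDerivAt
    rw [← hA] at h1
    exact h1
  obtain ⟨A₀, hA₀⟩ := hunit _ ⟨hO₀, hunit₀⟩
  set e := ((hSs.contDiffAt (hOo.mem_nhds hO₀)).toOpenPartialHomeomorph S hA₀
    (by simp)).restrOpen O' hO'o with he
  have heS : ∀ a, e a = S a := fun a => rfl
  have hemem : (x₀, t₀) ∈ e.source :=
    ⟨ContDiffAt.mem_toOpenPartialHomeomorph_source _ _ _, hO₀, hunit₀⟩
  have hesub : e.source ⊆ O' := fun a ha => ha.2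
  have hrs : ∀ b ∈ e.target, ContDiffAt ℝ ∞ e.symm b := by
    intro b hb'
    have hb2 := hesub (e.map_target hb')
    obtain ⟨A, hA⟩ := hunit _ hb2
    exact e.contDiffAt_symm hb' hA (hSs.contDiffAt (hOo.mem_nhds hb2.1))
  -- the transformed function
  set v : ℝ → ℝ → ℝ := fun x t => U (Y (e.symm (x, t))) with hv
  have hvs : ContDiffOn ℝ ∞ (Function.uncurry v) e.target := by
    intro b hb'
    have hb2 := hesub (e.map_target hb')
    have := (hUs.contDiffAt (hOo.mem_nhds hb2.1)).comp b (hrs b hb')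
    exact this.contDiffWithinAt
  obtain ⟨γ', f', -, hel, hsol⟩ := hΨ.maps_class γ f (Ioi 0 ×ˢ univ)
    (isOpen_Ioi.prod isOpen_univ) hfs
  have hgr : liftedGraph γ f e.source u ⊆
      elementGraph γ f (Ioi 0 ×ˢ univ) ∩ I ×ˢ J ×ˢ K ×ˢ L ×ˢ M := by
    rintro _ ⟨a, ha, rfl⟩
    have h1 := (hesub ha).1
    exact ⟨⟨⟨hb.pos h1.1.1, trivial⟩, rfl, rfl⟩, h1.1.1, h1.1.2.1, h1.1.2.2, hγ, h1.2⟩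
  have himg : ∀ a ∈ e.source, Ψ (a.1, a.2, u a.1 a.2, γ, f a.1 (u a.1 a.2)) =
      ((S a).1, (S a).2, v (S a).1 (S a).2, γ', f' (S a).1 (v (S a).1 (S a).2)) := by
    intro a ha
    have h1 := (hesub ha).1
    have h2 := hel _ (hgr ⟨a, ha, rfl⟩)
    have h3 := hc.eq _ h1.1.1 _ h1.1.2.1 _ h1.1.2.2 _ hγ _ h1.2
    have h4 : v (S a).1 (S a).2 = U (Y a) := by
      have : e.symm (S a) = a := e.left_inv ha
      simp only [hv, Prod.mk.eta, this]
    have h5 := h2.1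
    have h6 := h2.2
    dsimp only at h5 h6
    rw [h3] at h5 h6 ⊢
    rw [h4]
    refine Prod.ext rfl (Prod.ext rfl (Prod.ext rfl (Prod.ext h5 h6)))
  have himage : Ψ '' liftedGraph γ f e.source u = liftedGraph γ' f' e.target v := by
    ext z
    constructor
    · rintro ⟨_, ⟨a, ha, rfl⟩, rfl⟩
      exact ⟨S a, e.map_source ha, (himg a ha).symm⟩
    · rintro ⟨b, hb', rfl⟩
      refine ⟨_, ⟨e.symm b, e.map_target hb', rfl⟩, ?_⟩
      have h1 := himg _ (e.map_target hb')
      have h2 : S (e.symm b) = b := e.right_inv hb'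
      rw [h2] at h1
      exact h1
  have hsolv := (hsol e.source e.target u v e.open_source e.open_target
    hus.contDiffOn hvs hgr himage).1 (isSolutionOn_testFun x₀ t₀ u₀ p q r γ hk _)
  set X₀ := X y₀ with hX₀
  set T₀ := T y₀ with hT₀
  have hS₀ : S (x₀, t₀) = (X₀, T₀) := by simp only [hS, hY₀, hX₀, hT₀]
  have htgt : (X₀, T₀) ∈ e.target := by rw [← hS₀]; exact e.map_source hemem
  have hr₀ : e.symm (X₀, T₀) = (x₀, t₀) := by rw [← hS₀]; exact e.left_inv hemem
  have hpde := hsolv.2 X₀ T₀ htgt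
  have hfin := himg _ hemem
  have hγ' : γ' = g γ := by
    have h3 := hc.eq _ hy.1 _ hy.2.1 _ hy.2.2 _ hγ _ hM
    simp only [hu₀, hf₀] at hfin
    rw [h3] at hfin
    exact (congrArg (fun z : ExtSpace => z.2.2.2.1) hfin).symm
  have hΦ : f' X₀ (v X₀ T₀) = (Ψ (x₀, t₀, u₀, γ, q + x₀ ^ (2 * γ) * r)).f := by
    simp only [hu₀, hf₀, hS₀] at hfin
    rw [hfin]; rfl
  rw [hγ', hΦ, iteratedDeriv_two] at hpde
  -- the curve in the target along which only `x` varies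
  set c : ℝ → ℝ × ℝ := fun s => e.symm (s, T₀) with hcdef
  have hcs : ContDiffAt ℝ ∞ c X₀ :=
    (hrs _ htgt).comp X₀ (contDiffAt_id.prodMk contDiffAt_const)
  have hc0 : c X₀ = (x₀, t₀) := hr₀
  have hc1 : ContDiffAt ℝ ∞ (fun s => (c s).1) X₀ := hcs.fst
  have hc2 : ContDiffAt ℝ ∞ (fun s => (c s).2) X₀ := hcs.snd
  have hcev : ∀ᶠ s in nhds X₀, S (c s) = (s, T₀) := by
    have : ∀ᶠ s in nhds X₀, (s, T₀) ∈ e.target :=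
      (continuousAt_id.prodMk continuousAt_const).eventually_mem (e.open_target.mem_nhds htgt)
    exact this.mono fun s hs => e.right_inv hs
  have hYc : ContDiffAt ℝ ∞ (fun s => Y (c s)) X₀ := hYs.contDiffAt.comp X₀ hcs
  have hYc0 : Y (c X₀) = y₀ := by rw [hc0, hY₀]
  set ξ := deriv (fun s => (c s).1) X₀ with hξ
  set τ := deriv (fun s => (c s).2) X₀ with hτ
  set ξ₂ := deriv (deriv fun s => (c s).1) X₀ with hξ₂
  set τ₂ := deriv (deriv fun s => (c s).2) X₀ with hτ₂
  have hd1 : deriv (fun s => Y (c s)) X₀ = (ξ, τ, p * ξ + q * τ) := by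
    refine HasDerivAt.deriv ?_
    have h1 := (hc1.differentiableAt (by simp)).hasDerivAt
    have h2 := (hc2.differentiableAt (by simp)).hasDerivAt
    refine h1.prodMk (h2.prodMk ((hasDerivAt_testFun x₀ t₀ u₀ p q r hk h1 h2).congr_deriv ?_))
    simp [hc0, hξ, hτ]
  have hd2 : deriv (deriv fun s => Y (c s)) X₀ =
      (ξ₂, τ₂, p * ξ₂ + q * τ₂ + r * ξ ^ 2 + k * q * τ ^ 2) := by
    have h0 := (hYc.deriv_infty.differentiableAt (by simp)).hasDerivAt
    have hev : deriv (fun s => Y (c s)) =ᶠ[nhds X₀] fun s => (deriv (fun s => (c s).1) s,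
        deriv (fun s => (c s).2) s,
        deriv (fun s => testFun x₀ t₀ u₀ p q r k (c s).1 (c s).2) s) := by
      filter_upwards [(hYc.of_le two_le_infty).eventually (by simp)] with s hs
      have h1 := (hs.differentiableAt (by simp)).hasDerivAt
      exact Prod.ext h1.prod_fst.deriv.symm (Prod.ext h1.prod_snd.prod_fst.deriv.symm
        h1.prod_snd.prod_snd.deriv.symm)
    have h3 := h0.congr_of_eventuallyEq hev.symm
    refine Prod.ext h3.prod_fst.deriv.symm (Prod.ext h3.prod_snd.prod_fst.deriv.symm ?_)
    rw [← h3.prod_snd.prod_snd.deriv]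
    dsimp only
    rw [second_deriv_testFun x₀ t₀ u₀ p q r hk hc1 hc2]
    simp only [hc0, sub_self, mul_zero, add_zero, Real.exp_zero, mul_one]
    ring
  have hXc : (fun s => X (Y (c s))) =ᶠ[nhds X₀] id :=
    hcev.mono fun s hs => congrArg (fun a : ℝ × ℝ => a.1) hs
  have hTc : (fun s => T (Y (c s))) =ᶠ[nhds X₀] fun _ => T₀ :=
    hcev.mono fun s hs => congrArg (fun a : ℝ × ℝ => a.2) hs
  have hdat' : ∀ {Z : ℝ × ℝ × ℝ → ℝ}, ContDiffOn ℝ ∞ Z B → ContDiffAt ℝ ∞ Z (Y (c X₀)) :=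
    fun hZ => by rw [hYc0]; exact hdat hZ
  have hX1 := deriv_comp_curve (hdat' hc.smoothX) hYc
  have hT1 := deriv_comp_curve (hdat' hc.smoothT) hYc
  have hX2 := second_deriv_comp_curve (hdat' hc.smoothX) hYc
  have hT2 := second_deriv_comp_curve (hdat' hc.smoothT) hYc
  have hU2 := second_deriv_comp_curve (hdat' hc.smoothU) hYc
  rw [hXc.deriv_eq, hd1, hYc0, deriv_id] at hX1
  rw [hTc.deriv_eq, hd1, hYc0, deriv_const] at hT1
  rw [hXc.deriv.deriv_eq, hd1, hd2, hYc0, deriv_id', deriv_const] at hX2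
  rw [hTc.deriv.deriv_eq, hd1, hd2, hYc0, deriv_const', deriv_const] at hT2
  rw [hd1, hd2, hYc0] at hU2
  -- the curve in the target along which only `t` varies
  set d : ℝ → ℝ × ℝ := fun s => e.symm (X₀, s) with hddef
  have hds : ContDiffAt ℝ ∞ d T₀ :=
    (hrs _ htgt).comp T₀ (contDiffAt_const.prodMk contDiffAt_id)
  have hd0 : d T₀ = (x₀, t₀) := hr₀
  have hdev : ∀ᶠ s in nhds T₀, S (d s) = (X₀, s) := by
    have : ∀ᶠ s in nhds T₀, (X₀, s) ∈ e.target :=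
      (continuousAt_const.prodMk continuousAt_id).eventually_mem (e.open_target.mem_nhds htgt)
    exact this.mono fun s hs => e.right_inv hs
  have hYd : ContDiffAt ℝ ∞ (fun s => Y (d s)) T₀ := hYs.contDiffAt.comp T₀ hds
  have hYd0 : Y (d T₀) = y₀ := by rw [hd0, hY₀]
  set e₁ := deriv (fun s => (d s).1) T₀ with he₁
  set e₂ := deriv (fun s => (d s).2) T₀ with he₂
  have hdd : deriv (fun s => Y (d s)) T₀ = (e₁, e₂, p * e₁ + q * e₂) := by
    refine HasDerivAt.deriv ?_
    have h1 := (hds.fst.differentiableAt (by simp)).hasDerivAt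
    have h2 := (hds.snd.differentiableAt (by simp)).hasDerivAt
    refine h1.prodMk (h2.prodMk ((hasDerivAt_testFun x₀ t₀ u₀ p q r hk h1 h2).congr_deriv ?_))
    simp [hd0, he₁, he₂]
  have hXd : (fun s => X (Y (d s))) =ᶠ[nhds T₀] fun _ => X₀ :=
    hdev.mono fun s hs => congrArg (fun a : ℝ × ℝ => a.1) hs
  have hTd : (fun s => T (Y (d s))) =ᶠ[nhds T₀] id :=
    hdev.mono fun s hs => congrArg (fun a : ℝ × ℝ => a.2) hs
  have hdat'' : ∀ {Z : ℝ × ℝ × ℝ → ℝ}, ContDiffOn ℝ ∞ Z B → ContDiffAt ℝ ∞ Z (Y (d T₀)) :=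
    fun hZ => by rw [hYd0]; exact hdat hZ
  have hX3 := deriv_comp_curve (hdat'' hc.smoothX) hYd
  have hT3 := deriv_comp_curve (hdat'' hc.smoothT) hYd
  have hU3 := deriv_comp_curve (hdat'' hc.smoothU) hYd
  rw [hXd.deriv_eq, hdd, hYd0, deriv_const] at hX3
  rw [hTd.deriv_eq, hdd, hYd0, deriv_id] at hT3
  rw [hdd, hYd0] at hU3
  -- The witnesses are the first and second derivatives of the old `(x, t)` in the new `x`, and
  -- their first derivatives in the new `t`.
  refine ⟨ξ, τ, ξ₂, τ₂, e₁, e₂, hX1.symm, hT1.symm, hX3.symm, hT3.symm, hX2.symm, hT2.symm, ?_⟩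
  rw [← hU3, ← hU2]
  exact sub_eq_zero.1 hpde

/-! ### Differentials in coordinates. -/

theorem apply_coord (A : ℝ × ℝ × ℝ →L[ℝ] ℝ) (a b c : ℝ) :
    A (a, b, c) = a * A (1, 0, 0) + b * A (0, 1, 0) + c * A (0, 0, 1) := by
  have : ((a, b, c) : ℝ × ℝ × ℝ) = a • (1, 0, 0) + b • (0, 1, 0) + c • (0, 0, 1) := by simp
  rw [this, map_add, map_add, map_smul, map_smul, map_smul]
  rfl

theorem apply_apply_coord (Q : ℝ × ℝ × ℝ →L[ℝ] ℝ × ℝ × ℝ →L[ℝ] ℝ) (hQ : ∀ v w, Q v w = Q w v)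
    (a b c : ℝ) :
    Q (a, b, c) (a, b, c) = a ^ 2 * Q (1, 0, 0) (1, 0, 0) + b ^ 2 * Q (0, 1, 0) (0, 1, 0) +
      c ^ 2 * Q (0, 0, 1) (0, 0, 1) + 2 * a * b * Q (1, 0, 0) (0, 1, 0) +
      2 * a * c * Q (1, 0, 0) (0, 0, 1) + 2 * b * c * Q (0, 1, 0) (0, 0, 1) := by
  have : ((a, b, c) : ℝ × ℝ × ℝ) = a • (1, 0, 0) + b • (0, 1, 0) + c • (0, 0, 1) := by simp
  rw [this]
  simp only [map_add, map_smul, add_apply, smul_apply, smul_eq_mul]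
  rw [hQ (0, 1, 0) (1, 0, 0), hQ (0, 0, 1) (1, 0, 0), hQ (0, 0, 1) (0, 1, 0)]
  ring

theorem snd_fderiv_symm {Z : ℝ × ℝ × ℝ → ℝ} {y : ℝ × ℝ × ℝ} (hZ : ContDiffAt ℝ ∞ Z y)
    (v w : ℝ × ℝ × ℝ) :
    fderiv ℝ (fderiv ℝ Z) y v w = fderiv ℝ (fderiv ℝ Z) y w v :=
  (hZ.isSymmSndFDerivAt (by simpa using two_le_infty)).eq v w

theorem hasFDerivAt_fderiv_apply {Z : ℝ × ℝ × ℝ → ℝ} {y : ℝ × ℝ × ℝ} (hZ : ContDiffAt ℝ ∞ Z y)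
    (w : ℝ × ℝ × ℝ) :
    HasFDerivAt (fun y => fderiv ℝ Z y w) ((fderiv ℝ (fderiv ℝ Z) y).flip w) y := by
  have h := ((hZ.fderiv_right (m := ∞) (by simp)).differentiableAt (by simp)).hasFDerivAt
  exact (ContinuousLinearMap.apply ℝ ℝ w).hasFDerivAt.comp y h

theorem snd_fderiv_eq_zero {Z : ℝ × ℝ × ℝ → ℝ} {B : Set (ℝ × ℝ × ℝ)} (hB : IsOpen B)
    (hZ : ContDiffOn ℝ ∞ Z B) {w : ℝ × ℝ × ℝ} (h : ∀ y ∈ B, fderiv ℝ Z y w = 0)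
    {y : ℝ × ℝ × ℝ} (hy : y ∈ B) (v : ℝ × ℝ × ℝ) :
    fderiv ℝ (fderiv ℝ Z) y v w = 0 := by
  have h1 := hasFDerivAt_fderiv_apply (hZ.contDiffAt (hB.mem_nhds hy)) w
  have h2 := h1.unique ((hasFDerivAt_const (0 : ℝ) y).congr_of_eventuallyEq
    (Filter.eventuallyEq_of_mem (hB.mem_nhds hy) h))
  exact congrArg (fun A => A v) h2

/-! ### The determining equations. -/

namespace IsEquivalenceTransformation

variable {I J K L M : Set ℝ} {Ψ : ExtSpace → ExtSpace} {X T U : ℝ × ℝ × ℝ → ℝ} {g : ℝ → ℝ}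

/-- Since `X` and `U` do not involve `t` while `T_t ≠ 0`, a kernel vector of the `(x, u)`-block
extends, by solving for its `t`-component, to one of the full differential, which is injective. -/
theorem jacobian_ne_zero (hb : IsBox I J K L M)
    (hΨ : IsEquivalenceTransformation (I ×ˢ J ×ˢ K ×ˢ L ×ˢ M) Ψ)
    (hc : HasCoordinates I J K L M Ψ X T U g) {y : ℝ × ℝ × ℝ} (hy : y ∈ I ×ˢ J ×ˢ K) :
    fderiv ℝ U y (0, 0, 1) * fderiv ℝ X y (1, 0, 0) -
      fderiv ℝ U y (1, 0, 0) * fderiv ℝ X y (0, 0, 1) ≠ 0 := by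
  obtain ⟨hXt, hUt, hTt⟩ := fderiv_t hb hΨ hc hy
  have key : ∀ a c : ℝ, a * fderiv ℝ X y (1, 0, 0) + c * fderiv ℝ X y (0, 0, 1) = 0 →
      a * fderiv ℝ U y (1, 0, 0) + c * fderiv ℝ U y (0, 0, 1) = 0 → a = 0 ∧ c = 0 := by
    intro a c h1 h2
    have h := hc.inj y hy (a, -(a * fderiv ℝ T y (1, 0, 0) + c * fderiv ℝ T y (0, 0, 1)) /
      fderiv ℝ T y (0, 1, 0), c)
      (by rw [apply_coord, hXt]; linarith)
      (by rw [apply_coord]; field_simp; ring)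
      (by rw [apply_coord, hUt]; linarith)
    exact ⟨congrArg (fun z : ℝ × ℝ × ℝ => z.1) h, congrArg (fun z : ℝ × ℝ × ℝ => z.2.2) h⟩
  intro h0
  obtain ⟨h1, h2⟩ := key (fderiv ℝ X y (0, 0, 1)) (-fderiv ℝ X y (1, 0, 0)) (by ring) (by linarith)
  obtain ⟨h3, h4⟩ := key (fderiv ℝ U y (0, 0, 1)) (-fderiv ℝ U y (1, 0, 0))
    (by rw [h1, neg_eq_zero.1 h2]; ring) (by ring)
  have := key 1 1 (by rw [h1, neg_eq_zero.1 h2]; ring) (by rw [h3, neg_eq_zero.1 h4]; ring)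
  exact one_ne_zero this.1

/-- The transformed equation, evaluated on stationary solutions. -/
theorem stationary_identity (hb : IsBox I J K L M)
    (hΨ : IsEquivalenceTransformation (I ×ˢ J ×ˢ K ×ˢ L ×ˢ M) Ψ)
    (hc : HasCoordinates I J K L M Ψ X T U g) {x t u : ℝ} (hy : (x, t, u) ∈ I ×ˢ J ×ˢ K)
    {γ : ℝ} (hγ : γ ∈ L) {r : ℝ} (hr : x ^ (2 * γ) * r ∈ M) {p A B : ℝ}
    (hA : A = fderiv ℝ X (x, t, u) (1, 0, 0) + p * fderiv ℝ X (x, t, u) (0, 0, 1))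
    (hB : B = fderiv ℝ U (x, t, u) (1, 0, 0) + p * fderiv ℝ U (x, t, u) (0, 0, 1)) (hA0 : A ≠ 0) :
    (Ψ (x, t, u, γ, x ^ (2 * γ) * r)).f * A ^ 3 = X (x, t, u) ^ (2 * g γ) *
      ((fderiv ℝ (fderiv ℝ U) (x, t, u) (1, 0, 0) (1, 0, 0) +
          2 * p * fderiv ℝ (fderiv ℝ U) (x, t, u) (1, 0, 0) (0, 0, 1) +
          p ^ 2 * fderiv ℝ (fderiv ℝ U) (x, t, u) (0, 0, 1) (0, 0, 1)) * A -
        B * (fderiv ℝ (fderiv ℝ X) (x, t, u) (1, 0, 0) (1, 0, 0) +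
          2 * p * fderiv ℝ (fderiv ℝ X) (x, t, u) (1, 0, 0) (0, 0, 1) +
          p ^ 2 * fderiv ℝ (fderiv ℝ X) (x, t, u) (0, 0, 1) (0, 0, 1)) +
        r * (fderiv ℝ U (x, t, u) (0, 0, 1) * A - B * fderiv ℝ X (x, t, u) (0, 0, 1))) := by
  obtain ⟨hXt, hUt, hTt⟩ := fderiv_t hb hΨ hc hy
  have hBo := hb.isOpen_base
  have hXa := hc.smoothX.contDiffAt (hBo.mem_nhds hy)
  have hUa := hc.smoothU.contDiffAt (hBo.mem_nhds hy)
  have hX2 := snd_fderiv_eq_zero hBo hc.smoothX (fun y hy => (fderiv_t hb hΨ hc hy).1) hy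
  have hU2 := snd_fderiv_eq_zero hBo hc.smoothU (fun y hy => (fderiv_t hb hΨ hc hy).2.1) hy
  have hX2' := snd_fderiv_symm hXa
  have hU2' := snd_fderiv_symm hUa
  -- With `q = 0` the test function is independent of `t`, and the value of `k` is immaterial.
  obtain ⟨ξ, τ, ξ₂, τ₂, e₁, e₂, h1, h2, h3, h4, h5, h6, h7⟩ :=
    jet_identity hb hΨ hc hy hγ (p := p) (q := 0) (r := r) (k := 1) one_ne_zero
      (by rwa [zero_add]) (by
        intro a b ha hb'
        rw [apply_coord, hXt] at ha
        have ha0 : a * A = 0 := by rw [hA]; linarith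
        have ha1 : a = 0 := (mul_eq_zero.1 ha0).resolve_right hA0
        subst ha1
        rw [apply_coord] at hb'
        have : b * fderiv ℝ T (x, t, u) (0, 1, 0) = 0 := by linarith
        exact ⟨rfl, (mul_eq_zero.1 this).resolve_right hTt⟩)
  rw [apply_apply_coord _ hX2', apply_coord (fderiv ℝ X (x, t, u)) ξ₂, hX2, hX2, hX2' (0, 1, 0), hX2, hXt] at h5
  rw [apply_apply_coord _ hU2', apply_coord (fderiv ℝ U (x, t, u)) e₁,
    apply_coord (fderiv ℝ U (x, t, u)) ξ₂, hU2, hU2,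
    hU2' (0, 1, 0), hU2, hUt] at h7
  rw [apply_coord (fderiv ℝ X (x, t, u)), hXt] at h1 h3
  have h1' : ξ * A = 1 := by rw [hA]; linarith
  have h3' : e₁ * A = 0 := by rw [hA]; linarith
  have he : e₁ = 0 := (mul_eq_zero.1 h3').resolve_right hA0
  subst he
  have hξ : ξ = 1 / A := eq_div_of_mul_eq hA0 h1'
  rw [zero_add] at h7
  rw [← h7]
  set X11 := fderiv ℝ (fderiv ℝ X) (x, t, u) (1, 0, 0) (1, 0, 0)
  set X13 := fderiv ℝ (fderiv ℝ X) (x, t, u) (1, 0, 0) (0, 0, 1)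
  set X33 := fderiv ℝ (fderiv ℝ X) (x, t, u) (0, 0, 1) (0, 0, 1)
  set U11 := fderiv ℝ (fderiv ℝ U) (x, t, u) (1, 0, 0) (1, 0, 0)
  set U13 := fderiv ℝ (fderiv ℝ U) (x, t, u) (1, 0, 0) (0, 0, 1)
  set U33 := fderiv ℝ (fderiv ℝ U) (x, t, u) (0, 0, 1) (0, 0, 1)
  set Xu := fderiv ℝ X (x, t, u) (0, 0, 1)
  set Uu := fderiv ℝ U (x, t, u) (0, 0, 1)
  set Xx := fderiv ℝ X (x, t, u) (1, 0, 0)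
  set Ux := fderiv ℝ U (x, t, u) (1, 0, 0)
  have hξ₂ : ξ₂ = -(X11 + 2 * p * X13 + p ^ 2 * X33 + r * Xu) / A ^ 3 := by
    rw [eq_div_iff (pow_ne_zero 3 hA0)]
    have h8 : ξ₂ * A = -ξ ^ 2 * (X11 + 2 * p * X13 + p ^ 2 * X33 + r * Xu) := by
      rw [hA]; linarith
    have : ξ ^ 2 * A ^ 2 = 1 := by rw [← mul_pow, h1', one_pow]
    linear_combination A ^ 2 * h8 - (X11 + 2 * p * X13 + p ^ 2 * X33 + r * Xu) * this
  rw [hξ₂, hξ]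
  have hUx : Ux = B - p * Uu := by rw [hB]; ring
  rw [hUx]
  field_simp
  ring

/-- Subtract `stationary_identity` for two values of `f`. The right-hand side contains only the
Jacobian and is independent of `p`, while the left-hand side is a `p`-independent number times `A ^
3`. If `X_u ≠ 0`, a suitable slope `p` realises any `A`, and `A = 1, 2` contradict each other
because the right-hand side is nonzero. -/
theorem fderiv_X_u (hb : IsBox I J K L M)
    (hΨ : IsEquivalenceTransformation (I ×ˢ J ×ˢ K ×ˢ L ×ˢ M) Ψ)
    (hc : HasCoordinates I J K L M Ψ X T U g) {y : ℝ × ℝ × ℝ} (hy : y ∈ I ×ˢ J ×ˢ K) :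
    fderiv ℝ X y (0, 0, 1) = 0 := by
  obtain ⟨x, t, u⟩ := y
  obtain ⟨γ, hγ⟩ := hb.connL.nonempty
  obtain ⟨f₁, hf₁⟩ := hb.connM.nonempty
  obtain ⟨f₂, hf₂, hne, -⟩ := exists_ne_ne_of_isOpen hb.openM hb.connM.nonempty f₁ f₁
  have hx : 0 < x := hb.pos hy.1
  have hpow : x ^ (2 * γ) ≠ 0 := (Real.rpow_pos_of_pos hx _).ne'
  have hXp : 0 < X (x, t, u) := by
    have h := hΨ.pos (x, t, u, γ, f₁) ⟨hy.1, hy.2.1, hy.2.2, hγ, hf₁⟩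
    rwa [hc.eq x hy.1 t hy.2.1 u hy.2.2 γ hγ f₁ hf₁] at h
  have hXpow : X (x, t, u) ^ (2 * g γ) ≠ 0 := (Real.rpow_pos_of_pos hXp _).ne'
  have hδ := jacobian_ne_zero hb hΨ hc hy
  by_contra h0
  have key : ∀ A : ℝ, A ≠ 0 → ((Ψ (x, t, u, γ, f₁)).f - (Ψ (x, t, u, γ, f₂)).f) * A ^ 3 =
      X (x, t, u) ^ (2 * g γ) * ((f₁ - f₂) / x ^ (2 * γ) *
        (fderiv ℝ U (x, t, u) (0, 0, 1) * fderiv ℝ X (x, t, u) (1, 0, 0) -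
      fderiv ℝ U (x, t, u) (1, 0, 0) * fderiv ℝ X (x, t, u) (0, 0, 1))) := by
    intro A hA
    have hA' : A = fderiv ℝ X (x, t, u) (1, 0, 0) +
        (A - fderiv ℝ X (x, t, u) (1, 0, 0)) / fderiv ℝ X (x, t, u) (0, 0, 1) *
          fderiv ℝ X (x, t, u) (0, 0, 1) := by
      field_simp
      ring
    set p := (A - fderiv ℝ X (x, t, u) (1, 0, 0)) / fderiv ℝ X (x, t, u) (0, 0, 1)
    have e1 : x ^ (2 * γ) * (f₁ / x ^ (2 * γ)) = f₁ := mul_div_cancel₀ _ hpow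
    have e2 : x ^ (2 * γ) * (f₂ / x ^ (2 * γ)) = f₂ := mul_div_cancel₀ _ hpow
    have s1 := stationary_identity hb hΨ hc hy hγ (r := f₁ / x ^ (2 * γ)) (by rwa [e1]) hA' rfl hA
    have s2 := stationary_identity hb hΨ hc hy hγ (r := f₂ / x ^ (2 * γ)) (by rwa [e2]) hA' rfl hA
    rw [e1] at s1
    rw [e2] at s2
    rw [sub_mul, s1, s2]
    have : fderiv ℝ X (x, t, u) (1, 0, 0) = A - p * fderiv ℝ X (x, t, u) (0, 0, 1) := by linarith
    rw [this]
    ring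
  have k1 := key 1 one_ne_zero
  have k2 := key 2 two_ne_zero
  have h3 : (f₁ - f₂) / x ^ (2 * γ) ≠ 0 := div_ne_zero (sub_ne_zero.2 hne.symm) hpow
  have h4 := mul_ne_zero hXpow (mul_ne_zero h3 hδ)
  apply h4
  linarith

/-- The transformed equation, evaluated on a non-stationary test solution. -/
theorem evolution_identity (hb : IsBox I J K L M)
    (hΨ : IsEquivalenceTransformation (I ×ˢ J ×ˢ K ×ˢ L ×ˢ M) Ψ)
    (hc : HasCoordinates I J K L M Ψ X T U g) {x t u : ℝ} (hy : (x, t, u) ∈ I ×ˢ J ×ˢ K)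
    {γ : ℝ} (hγ : γ ∈ L) {p q r k E : ℝ} (hk : k ≠ 0) (hM : q + x ^ (2 * γ) * r ∈ M)
    (hE : E = fderiv ℝ T (x, t, u) (0, 1, 0) + q * fderiv ℝ T (x, t, u) (0, 0, 1)) (hE0 : E ≠ 0)
    {a b τ : ℝ} (ha : a * fderiv ℝ X (x, t, u) (1, 0, 0) = 1)
    (hb' : b = -a ^ 3 * fderiv ℝ (fderiv ℝ X) (x, t, u) (1, 0, 0) (1, 0, 0))
    (hτ : τ * E = -a * (fderiv ℝ T (x, t, u) (1, 0, 0) + p * fderiv ℝ T (x, t, u) (0, 0, 1))) :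
    ∃ τ₂ : ℝ,
      fderiv ℝ (fderiv ℝ T) (x, t, u) (a, τ, p * a + q * τ) (a, τ, p * a + q * τ) +
        (b * fderiv ℝ T (x, t, u) (1, 0, 0) + τ₂ * fderiv ℝ T (x, t, u) (0, 1, 0) +
          (p * b + q * τ₂ + r * a ^ 2 + k * q * τ ^ 2) * fderiv ℝ T (x, t, u) (0, 0, 1)) = 0 ∧
      q * fderiv ℝ U (x, t, u) (0, 0, 1) / E + X (x, t, u) ^ (2 * g γ) *
        (fderiv ℝ (fderiv ℝ U) (x, t, u) (a, τ, p * a + q * τ) (a, τ, p * a + q * τ) +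
        (b * fderiv ℝ U (x, t, u) (1, 0, 0) +
          (p * b + q * τ₂ + r * a ^ 2 + k * q * τ ^ 2) * fderiv ℝ U (x, t, u) (0, 0, 1))) =
      (Ψ (x, t, u, γ, q + x ^ (2 * γ) * r)).f := by
  have hBo := hb.isOpen_base
  obtain ⟨hXt, hUt, -⟩ := fderiv_t hb hΨ hc hy
  have hXu := fderiv_X_u hb hΨ hc hy
  have hX2 := snd_fderiv_eq_zero hBo hc.smoothX (fun y hy => (fderiv_t hb hΨ hc hy).1) hy
  have hX3 := snd_fderiv_eq_zero hBo hc.smoothX (fun y hy => fderiv_X_u hb hΨ hc hy) hy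
  have hX2' := snd_fderiv_symm (hc.smoothX.contDiffAt (hBo.mem_nhds hy))
  have hXx : fderiv ℝ X (x, t, u) (1, 0, 0) ≠ 0 := right_ne_zero_of_mul (ha ▸ one_ne_zero)
  obtain ⟨ξ, σ, ξ₂, τ₂, e₁, e₂, h1, h2, h3, h4, h5, h6, h7⟩ :=
    jet_identity hb hΨ hc hy hγ (p := p) (q := q) (r := r) (k := k) hk hM (by
        intro a b ha hb'
        rw [apply_coord, hXt, hXu] at ha
        have ha0 : a * fderiv ℝ X (x, t, u) (1, 0, 0) = 0 := by linarith
        have ha1 : a = 0 := (mul_eq_zero.1 ha0).resolve_right hXx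
        subst ha1
        rw [apply_coord] at hb'
        have : b * E = 0 := by rw [hE]; linarith
        exact ⟨rfl, (mul_eq_zero.1 this).resolve_right hE0⟩)
  rw [apply_coord (fderiv ℝ X (x, t, u)), hXt, hXu] at h1 h3
  have hξ : ξ = a := by
    apply mul_right_cancel₀ hXx
    rw [ha]; linarith
  subst hξ
  have he : e₁ = 0 := by
    have : e₁ * fderiv ℝ X (x, t, u) (1, 0, 0) = 0 := by linarith
    exact (mul_eq_zero.1 this).resolve_right hXx
  subst he
  rw [apply_coord (fderiv ℝ T (x, t, u))] at h2 h4
  have hσ : σ = τ := by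
    apply mul_right_cancel₀ hE0
    rw [hτ, hE]; linarith
  subst hσ
  have he₂ : e₂ = 1 / E := by
    rw [eq_div_iff hE0, hE]; linarith
  rw [apply_apply_coord _ hX2', apply_coord (fderiv ℝ X (x, t, u)) ξ₂, hX3, hX3, hX3, hX2, hX2,
    hXt, hXu] at h5
  have hξ₂ : ξ₂ = b := by
    apply mul_right_cancel₀ hXx
    rw [hb']
    linear_combination h5 + ξ ^ 2 * fderiv ℝ (fderiv ℝ X) (x, t, u) (1, 0, 0) (1, 0, 0) * ha
  subst hξ₂
  rw [apply_coord (fderiv ℝ T (x, t, u)) ξ₂] at h6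
  rw [apply_coord (fderiv ℝ U (x, t, u)) 0, apply_coord (fderiv ℝ U (x, t, u)) ξ₂, hUt, he₂] at h7
  refine ⟨τ₂, h6, ?_⟩
  rw [← h7]
  ring

/-- `T` depends on `t` only. -/
theorem fderiv_T_x_u (hb : IsBox I J K L M)
    (hΨ : IsEquivalenceTransformation (I ×ˢ J ×ˢ K ×ˢ L ×ˢ M) Ψ)
    (hc : HasCoordinates I J K L M Ψ X T U g) {y : ℝ × ℝ × ℝ} (hy : y ∈ I ×ˢ J ×ˢ K) :
    fderiv ℝ T y (1, 0, 0) = 0 ∧ fderiv ℝ T y (0, 0, 1) = 0 := by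
  obtain ⟨x, t, u⟩ := y
  obtain ⟨γ, hγ⟩ := hb.connL.nonempty
  obtain ⟨f, hf⟩ := hb.connM.nonempty
  have hx : 0 < x := hb.pos hy.1
  have hpow : x ^ (2 * γ) ≠ 0 := (Real.rpow_pos_of_pos hx _).ne'
  have hXp : 0 < X (x, t, u) := by
    have h := hΨ.pos (x, t, u, γ, f) ⟨hy.1, hy.2.1, hy.2.2, hγ, hf⟩
    rwa [hc.eq x hy.1 t hy.2.1 u hy.2.2 γ hγ f hf] at h
  have hXpow : X (x, t, u) ^ (2 * g γ) ≠ 0 := (Real.rpow_pos_of_pos hXp _).ne'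
  obtain ⟨-, -, hTt⟩ := fderiv_t hb hΨ hc hy
  have hδ := jacobian_ne_zero hb hΨ hc hy
  rw [fderiv_X_u hb hΨ hc hy, mul_zero, sub_zero] at hδ
  have hXx := right_ne_zero_of_mul hδ
  have hUu := left_ne_zero_of_mul hδ
  -- The choice ensures `q ≠ 0` and `E ≠ 0`. If `T_u = 0`, the second excluded value is `0` by the
  -- convention on division, and `E = T_t` is nonzero anyway.
  obtain ⟨q, -, hq, hqT⟩ := exists_ne_ne_of_isOpen isOpen_univ univ_nonempty 0
    (-fderiv ℝ T (x, t, u) (0, 1, 0) / fderiv ℝ T (x, t, u) (0, 0, 1))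
  set E := fderiv ℝ T (x, t, u) (0, 1, 0) + q * fderiv ℝ T (x, t, u) (0, 0, 1) with hE
  have hE0 : E ≠ 0 := by
    intro h0
    by_cases hTu : fderiv ℝ T (x, t, u) (0, 0, 1) = 0
    · rw [hE, hTu, mul_zero, add_zero] at h0
      exact hTt h0
    · exact hqT ((eq_div_iff hTu).2 (by linarith))
  have hr : q + x ^ (2 * γ) * ((f - q) / x ^ (2 * γ)) = f := by
    rw [mul_div_cancel₀ _ hpow]; ring
  set r := (f - q) / x ^ (2 * γ)
  have ha : 1 / fderiv ℝ X (x, t, u) (1, 0, 0) * fderiv ℝ X (x, t, u) (1, 0, 0) = 1 :=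
    one_div_mul_cancel hXx
  set a := 1 / fderiv ℝ X (x, t, u) (1, 0, 0)
  have ha0 : a ≠ 0 := left_ne_zero_of_mul (ha ▸ one_ne_zero)
  have key : ∀ p : ℝ,
      fderiv ℝ T (x, t, u) (1, 0, 0) + p * fderiv ℝ T (x, t, u) (0, 0, 1) = 0 := by
    intro p
    have hτ : -a * (fderiv ℝ T (x, t, u) (1, 0, 0) + p * fderiv ℝ T (x, t, u) (0, 0, 1)) / E * E =
        -a * (fderiv ℝ T (x, t, u) (1, 0, 0) + p * fderiv ℝ T (x, t, u) (0, 0, 1)) :=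
      div_mul_cancel₀ _ hE0
    set τ := -a * (fderiv ℝ T (x, t, u) (1, 0, 0) + p * fderiv ℝ T (x, t, u) (0, 0, 1)) / E
    -- The values `k = 1` and `k = 2` share the same `f`. The `U`-relations give equal second
    -- derivatives of `u` along the curve, the `T`-relations then give `τ₁ = τ₂`, and what remains
    -- is `q τ² = 0`.
    obtain ⟨τ₁, h1, h2⟩ := evolution_identity hb hΨ hc hy hγ (r := r) one_ne_zero
      (by rwa [hr]) hE hE0 ha rfl hτ
    obtain ⟨τ₂, h3, h4⟩ := evolution_identity hb hΨ hc hy hγ (r := r) two_ne_zero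
      (by rwa [hr]) hE hE0 ha rfl hτ
    have h5 := mul_left_cancel₀ hXpow (add_left_cancel (h2.trans h4.symm))
    have h6 := mul_right_cancel₀ hUu (add_left_cancel (add_left_cancel h5))
    rw [h6] at h1
    have h7 : τ₁ = τ₂ := by
      apply mul_right_cancel₀ hTt
      linarith
    rw [h7] at h6
    have h8 : q * τ ^ 2 = 0 := by linarith
    have h9 : τ = 0 := pow_eq_zero_iff (two_ne_zero) |>.1 ((mul_eq_zero.1 h8).resolve_left hq)
    rw [h9, zero_mul] at hτ
    exact (mul_eq_zero.1 hτ.symm).resolve_left (neg_ne_zero.2 ha0)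
  have k0 := key 0
  have k1 := key 1
  constructor <;> linarith

/-- The determining equations of an equivalence transformation. -/
theorem determining_equations (hb : IsBox I J K L M)
    (hΨ : IsEquivalenceTransformation (I ×ˢ J ×ˢ K ×ˢ L ×ˢ M) Ψ)
    (hc : HasCoordinates I J K L M Ψ X T U g) {x t u : ℝ} (hy : (x, t, u) ∈ I ×ˢ J ×ˢ K) :
    fderiv ℝ X (x, t, u) (1, 0, 0) ≠ 0 ∧ fderiv ℝ U (x, t, u) (0, 0, 1) ≠ 0 ∧
    fderiv ℝ (fderiv ℝ U) (x, t, u) (0, 0, 1) (0, 0, 1) = 0 ∧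
    2 * fderiv ℝ (fderiv ℝ U) (x, t, u) (1, 0, 0) (0, 0, 1) * fderiv ℝ X (x, t, u) (1, 0, 0) =
      fderiv ℝ U (x, t, u) (0, 0, 1) * fderiv ℝ (fderiv ℝ X) (x, t, u) (1, 0, 0) (1, 0, 0) ∧
    ∀ γ ∈ L,
      fderiv ℝ X (x, t, u) (1, 0, 0) ^ 2 * x ^ (2 * γ) =
        fderiv ℝ T (x, t, u) (0, 1, 0) * X (x, t, u) ^ (2 * g γ) ∧
      ∀ f ∈ M, (Ψ (x, t, u, γ, f)).f * fderiv ℝ X (x, t, u) (1, 0, 0) ^ 3 =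
        X (x, t, u) ^ (2 * g γ) *
          (fderiv ℝ (fderiv ℝ U) (x, t, u) (1, 0, 0) (1, 0, 0) * fderiv ℝ X (x, t, u) (1, 0, 0) -
            fderiv ℝ U (x, t, u) (1, 0, 0) *
              fderiv ℝ (fderiv ℝ X) (x, t, u) (1, 0, 0) (1, 0, 0) +
            f / x ^ (2 * γ) * (fderiv ℝ U (x, t, u) (0, 0, 1) *
              fderiv ℝ X (x, t, u) (1, 0, 0))) := by
  have hx : 0 < x := hb.pos hy.1
  have hpow : ∀ γ : ℝ, x ^ (2 * γ) ≠ 0 := fun γ => (Real.rpow_pos_of_pos hx _).ne'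
  have hXp : 0 < X (x, t, u) := by
    obtain ⟨γ, hγ⟩ := hb.connL.nonempty
    obtain ⟨f, hf⟩ := hb.connM.nonempty
    have h := hΨ.pos (x, t, u, γ, f) ⟨hy.1, hy.2.1, hy.2.2, hγ, hf⟩
    rwa [hc.eq x hy.1 t hy.2.1 u hy.2.2 γ hγ f hf] at h
  have hXpow : ∀ a : ℝ, X (x, t, u) ^ a ≠ 0 := fun a => (Real.rpow_pos_of_pos hXp _).ne'
  have hBo := hb.isOpen_base
  have hXa := hc.smoothX.contDiffAt (hBo.mem_nhds hy)
  have hUa := hc.smoothU.contDiffAt (hBo.mem_nhds hy)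
  obtain ⟨hXt, hUt, hTt⟩ := fderiv_t hb hΨ hc hy
  have hXu := fderiv_X_u hb hΨ hc hy
  have hX2 := snd_fderiv_eq_zero hBo hc.smoothX (fun y hy => (fderiv_t hb hΨ hc hy).1) hy
  have hX3 := snd_fderiv_eq_zero hBo hc.smoothX (fun y hy => fderiv_X_u hb hΨ hc hy) hy
  have hU2 := snd_fderiv_eq_zero hBo hc.smoothU (fun y hy => (fderiv_t hb hΨ hc hy).2.1) hy
  have hX2' := snd_fderiv_symm hXa
  have hU2' := snd_fderiv_symm hUa
  have hδ := jacobian_ne_zero hb hΨ hc hy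
  rw [hXu, mul_zero, sub_zero] at hδ
  have hXx := right_ne_zero_of_mul hδ
  have hUu := left_ne_zero_of_mul hδ
  have hstat : ∀ γ ∈ L, ∀ f ∈ M, ∀ p : ℝ,
      (Ψ (x, t, u, γ, f)).f * fderiv ℝ X (x, t, u) (1, 0, 0) ^ 3 =
        X (x, t, u) ^ (2 * g γ) *
          ((fderiv ℝ (fderiv ℝ U) (x, t, u) (1, 0, 0) (1, 0, 0) +
          2 * p * fderiv ℝ (fderiv ℝ U) (x, t, u) (1, 0, 0) (0, 0, 1) +
          p ^ 2 * fderiv ℝ (fderiv ℝ U) (x, t, u) (0, 0, 1) (0, 0, 1)) *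
            fderiv ℝ X (x, t, u) (1, 0, 0) -
            (fderiv ℝ U (x, t, u) (1, 0, 0) + p * fderiv ℝ U (x, t, u) (0, 0, 1)) *
              fderiv ℝ (fderiv ℝ X) (x, t, u) (1, 0, 0) (1, 0, 0) +
            f / x ^ (2 * γ) * (fderiv ℝ U (x, t, u) (0, 0, 1) *
              fderiv ℝ X (x, t, u) (1, 0, 0))) := by
    intro γ hγ f hf p
    have e1 : x ^ (2 * γ) * (f / x ^ (2 * γ)) = f := mul_div_cancel₀ _ (hpow γ)
    have s1 := stationary_identity hb hΨ hc hy hγ (r := f / x ^ (2 * γ)) (p := p) (by rwa [e1])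
      (show fderiv ℝ X (x, t, u) (1, 0, 0) = _ by rw [hXu, mul_zero, add_zero]) rfl hXx
    rw [e1, hX3, hX3, hXu] at s1
    rw [s1]
    ring
  -- The new `f` does not depend on `p`, so the coefficients of `p` and `p²` in `hstat` vanish; `p =
  -- 0, 1, -1` separate them.
  have hcombine : fderiv ℝ (fderiv ℝ U) (x, t, u) (0, 0, 1) (0, 0, 1) = 0 ∧
      2 * fderiv ℝ (fderiv ℝ U) (x, t, u) (1, 0, 0) (0, 0, 1) * fderiv ℝ X (x, t, u) (1, 0, 0) =
      fderiv ℝ U (x, t, u) (0, 0, 1) * fderiv ℝ (fderiv ℝ X) (x, t, u) (1, 0, 0) (1, 0, 0) := by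
    obtain ⟨γ, hγ⟩ := hb.connL.nonempty
    obtain ⟨f, hf⟩ := hb.connM.nonempty
    have p0 := hstat γ hγ f hf 0
    have p1 := mul_left_cancel₀ (hXpow _) (p0.symm.trans (hstat γ hγ f hf 1))
    have p2 := mul_left_cancel₀ (hXpow _) (p0.symm.trans (hstat γ hγ f hf (-1)))
    have h33 : fderiv ℝ (fderiv ℝ U) (x, t, u) (0, 0, 1) (0, 0, 1) *
        fderiv ℝ X (x, t, u) (1, 0, 0) = 0 := by linarith
    refine ⟨(mul_eq_zero.1 h33).resolve_right hXx, by linarith⟩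
  refine ⟨hXx, hUu, hcombine.1, hcombine.2, fun γ hγ => ⟨?_, fun f hf => ?_⟩⟩
  · obtain ⟨f, hf⟩ := hb.connM.nonempty
    obtain ⟨hTx, hTu⟩ := fderiv_T_x_u hb hΨ hc hy
    have hT1 := snd_fderiv_eq_zero hBo hc.smoothT (fun y hy => (fderiv_T_x_u hb hΨ hc hy).1) hy
    have hr : 1 + x ^ (2 * γ) * ((f - 1) / x ^ (2 * γ)) = f := by
      rw [mul_div_cancel₀ _ (hpow γ)]; ring
    have ha : 1 / fderiv ℝ X (x, t, u) (1, 0, 0) * fderiv ℝ X (x, t, u) (1, 0, 0) = 1 :=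
      one_div_mul_cancel hXx
    set a := 1 / fderiv ℝ X (x, t, u) (1, 0, 0) with ha_def
    have hT3 := snd_fderiv_eq_zero hBo hc.smoothT (fun y hy => (fderiv_T_x_u hb hΨ hc hy).2) hy
    have hTsymm := snd_fderiv_symm (hc.smoothT.contDiffAt (hBo.mem_nhds hy))
    -- The jet with `q = 1` is balanced by `r` so as to have the same `f` as the stationary one;
    -- equating the two expressions for the new `f` isolates the coefficient of `u_t`.
    obtain ⟨τ₂, h1, h2⟩ := evolution_identity hb hΨ hc hy hγ (p := 0) (q := 1)
      (r := (f - 1) / x ^ (2 * γ)) (k := 1) (τ := 0) one_ne_zero (by rwa [hr])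
      (E := fderiv ℝ T (x, t, u) (0, 1, 0)) (by rw [hTu]; ring) hTt ha rfl
      (by rw [hTx, hTu]; ring)
    rw [apply_apply_coord _ hTsymm, hT1, hT3, hTx, hTu] at h1
    have hτ₂ : τ₂ * fderiv ℝ T (x, t, u) (0, 1, 0) = 0 := by linarith
    rw [(mul_eq_zero.1 hτ₂).resolve_right hTt, hr, apply_apply_coord _ hU2', ha_def] at h2
    have h3 := hstat γ hγ f hf 0
    rw [← h2] at h3
    have hX := hXpow (2 * g γ)
    have hp := hpow γ
    field_simp at h3
    have h4 : fderiv ℝ U (x, t, u) (0, 0, 1) * fderiv ℝ X (x, t, u) (1, 0, 0) *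
          (fderiv ℝ X (x, t, u) (1, 0, 0) ^ 2 * x ^ (2 * γ)) =
      fderiv ℝ U (x, t, u) (0, 0, 1) * fderiv ℝ X (x, t, u) (1, 0, 0) *
        (fderiv ℝ T (x, t, u) (0, 1, 0) * X (x, t, u) ^ (2 * g γ)) := by
      linear_combination h3
    exact mul_left_cancel₀ hδ h4
  · rw [hstat γ hγ f hf 0]
    ring

end IsEquivalenceTransformation

/-! ### Integration of the determining equations. -/

/-- The member with exponent `c` of the family of equivalence transformations. -/
noncomputable def powerMap (c ζ₀ ζ₁ : ℝ) (F : ℝ → ℝ) (z : ExtSpace) : ExtSpace :=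
  (z.x ^ c,
   ζ₀ + c ^ 2 * z.t,
   z.x ^ ((c - 1) / 2) * (ζ₁ * z.u + F z.x),
   1 + (z.γ - 1) / c,
   (1 / 4 : ℝ) * z.x ^ ((c - 5) / 2) *
     ((1 / c ^ 2 - 1) * z.x ^ (2 * z.γ) * (ζ₁ * z.u + F z.x)
       + 4 / c ^ 2 * z.x ^ 2 * (ζ₁ * z.f + z.x ^ (2 * z.γ) * iteratedDeriv 2 F z.x)))

theorem hasDerivAt_along {Z : ℝ × ℝ × ℝ → ℝ} {B : Set (ℝ × ℝ × ℝ)} (hB : IsOpen B)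
    (hZ : ContDiffOn ℝ ∞ Z B) {ℓ : ℝ → ℝ × ℝ × ℝ} {w : ℝ × ℝ × ℝ} {a : ℝ}
    (hℓ : HasDerivAt ℓ w a) (ha : ℓ a ∈ B) :
    HasDerivAt (fun s => Z (ℓ s)) (fderiv ℝ Z (ℓ a) w) a :=
  ((hZ.contDiffAt (hB.mem_nhds ha)).differentiableAt (by simp)).hasFDerivAt.comp_hasDerivAt a hℓ

theorem hasDerivAt_fderiv_along {Z : ℝ × ℝ × ℝ → ℝ} {B : Set (ℝ × ℝ × ℝ)} (hB : IsOpen B)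
    (hZ : ContDiffOn ℝ ∞ Z B) {ℓ : ℝ → ℝ × ℝ × ℝ} {w : ℝ × ℝ × ℝ} {a : ℝ}
    (hℓ : HasDerivAt ℓ w a) (ha : ℓ a ∈ B) (v : ℝ × ℝ × ℝ) :
    HasDerivAt (fun s => fderiv ℝ Z (ℓ s) v) (fderiv ℝ (fderiv ℝ Z) (ℓ a) w v) a :=
  (hasFDerivAt_fderiv_apply (hZ.contDiffAt (hB.mem_nhds ha)) v).comp_hasDerivAt a hℓ

theorem eq_of_hasDerivAt_zero {s : Set ℝ} (hs : IsOpen s) (hs' : IsConnected s) {h : ℝ → ℝ}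
    (hd : ∀ a ∈ s, HasDerivAt h 0 a) {a b : ℝ} (ha : a ∈ s) (hb : b ∈ s) : h a = h b :=
  hs.is_const_of_deriv_eq_zero hs'.isPreconnected
    (fun a ha => (hd a ha).differentiableAt.differentiableWithinAt)
    (fun a ha => (hd a ha).deriv) ha hb

theorem hasDerivAt_line_x (t u a : ℝ) :
    HasDerivAt (fun s : ℝ => ((s, t, u) : ℝ × ℝ × ℝ)) (1, 0, 0) a :=
  (hasDerivAt_id a).prodMk ((hasDerivAt_const a t).prodMk (hasDerivAt_const a u))

theorem hasDerivAt_line_t (x u a : ℝ) :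
    HasDerivAt (fun s : ℝ => ((x, s, u) : ℝ × ℝ × ℝ)) (0, 1, 0) a :=
  (hasDerivAt_const a x).prodMk ((hasDerivAt_id a).prodMk (hasDerivAt_const a u))

theorem hasDerivAt_line_u (x t a : ℝ) :
    HasDerivAt (fun s : ℝ => ((x, t, s) : ℝ × ℝ × ℝ)) (0, 0, 1) a :=
  (hasDerivAt_const a x).prodMk ((hasDerivAt_const a t).prodMk (hasDerivAt_id a))

theorem hasDerivAt_rpow {x : ℝ} (hx : 0 < x) (c : ℝ) :
    HasDerivAt (fun s : ℝ => s ^ c) (c * x ^ (c - 1)) x :=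
  Real.hasDerivAt_rpow_const (Or.inl hx.ne')

/-- The formula for the transformed `f`. -/
theorem transformed_f_eq {x c γ w F₁ F₂ f ζ₁ φ : ℝ} (hx : 0 < x) (hc : c ≠ 0)
    (h : φ * (c * x ^ (c - 1)) ^ 3 = (x ^ c) ^ (2 * (1 + (γ - 1) / c)) *
      ((((c - 1) / 2) * ((c - 1) / 2 - 1) * x ^ ((c - 1) / 2 - 2) * w +
          2 * (((c - 1) / 2) * x ^ ((c - 1) / 2 - 1)) * F₁ + x ^ ((c - 1) / 2) * F₂) *
          (c * x ^ (c - 1)) -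
        (((c - 1) / 2) * x ^ ((c - 1) / 2 - 1) * w + x ^ ((c - 1) / 2) * F₁) *
          (c * ((c - 1) * x ^ (c - 1 - 1))) +
        f / x ^ (2 * γ) * ((x ^ ((c - 1) / 2) * ζ₁) * (c * x ^ (c - 1))))) :
    φ = (1 / 4 : ℝ) * x ^ ((c - 5) / 2) *
      ((1 / c ^ 2 - 1) * x ^ (2 * γ) * w + 4 / c ^ 2 * x ^ 2 * (ζ₁ * f + x ^ (2 * γ) * F₂)) := by
  have hP : 0 < x ^ (c - 1) := Real.rpow_pos_of_pos hx _
  have hR : 0 < x ^ (2 * γ) := Real.rpow_pos_of_pos hx _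
  have e1 : (x ^ c) ^ (2 * (1 + (γ - 1) / c)) = x ^ (2 * γ) * (x ^ (c - 1)) ^ 2 := by
    rw [← Real.rpow_mul hx.le, ← Real.rpow_natCast (x ^ (c - 1)), ← Real.rpow_mul hx.le,
      ← Real.rpow_add hx]
    congr 1
    field_simp
    push_cast
    ring
  have e2 : x ^ ((c - 1) / 2 - 1) = x ^ ((c - 1) / 2) / x := by rw [Real.rpow_sub_one hx.ne']
  have e3 : x ^ ((c - 1) / 2 - 2) = x ^ ((c - 1) / 2) / x ^ 2 := by
    rw [Real.rpow_sub hx, Real.rpow_two]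
  have e4 : x ^ ((c - 5) / 2) = x ^ ((c - 1) / 2) / x ^ 2 := by
    rw [← e3]; congr 1; ring
  have e5 : x ^ (c - 1 - 1) = x ^ (c - 1) / x := by rw [Real.rpow_sub_one hx.ne']
  rw [e1, e2, e3, e5] at h
  rw [e4]
  have hx0 := hx.ne'
  have hP0 := hP.ne'
  have hR0 := hR.ne'
  generalize x ^ (c - 1) = P at *
  generalize x ^ (2 * γ) = R at *
  generalize x ^ ((c - 1) / 2) = Q at *
  -- The terms with `F₁` cancel because twice the weight `(c - 1) / 2` is `c - 1`; the rest has the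
  -- common factor `c * P ^ 3`.
  have h' : (c * P ^ 3) * (φ * c ^ 2) = (c * P ^ 3) *
      ((1 / 4 : ℝ) * (Q / x ^ 2) * ((1 - c ^ 2) * R * w + 4 * x ^ 2 * (ζ₁ * f + R * F₂))) := by
    rw [show (c * P ^ 3) * (φ * c ^ 2) = φ * (c * P) ^ 3 by ring, h]
    field_simp
    ring
  have h2 := mul_left_cancel₀ (mul_ne_zero hc (pow_ne_zero 3 hP0)) h'
  rw [eq_div_of_mul_eq (pow_ne_zero 2 hc) h2]
  field_simp

namespace IsEquivalenceTransformation

variable {I J K L M : Set ℝ} {Ψ : ExtSpace → ExtSpace} {X T U : ℝ × ℝ × ℝ → ℝ} {g : ℝ → ℝ}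

theorem fderiv_X_of_eq_rpow (hb : IsBox I J K L M) (hc : HasCoordinates I J K L M Ψ X T U g)
    {c : ℝ} (hX : ∀ x ∈ I, ∀ t ∈ J, ∀ u ∈ K, X (x, t, u) = x ^ c) :
    ∀ x ∈ I, ∀ t ∈ J, ∀ u ∈ K, fderiv ℝ X (x, t, u) (1, 0, 0) = c * x ^ (c - 1) ∧
      fderiv ℝ (fderiv ℝ X) (x, t, u) (1, 0, 0) (1, 0, 0) = c * ((c - 1) * x ^ (c - 1 - 1)) := by
  have hBo := hb.isOpen_base
  have hXx : ∀ x ∈ I, ∀ t ∈ J, ∀ u ∈ K, fderiv ℝ X (x, t, u) (1, 0, 0) = c * x ^ (c - 1) := by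
    intro x hx t ht u hu
    have h1 := hasDerivAt_along hBo hc.smoothX (hasDerivAt_line_x t u x) ⟨hx, ht, hu⟩
    refine h1.unique ((hasDerivAt_rpow (hb.pos hx) c).congr_of_eventuallyEq ?_)
    filter_upwards [hb.openI.mem_nhds hx] with s hs using hX s hs t ht u hu
  intro x hx t ht u hu
  refine ⟨hXx x hx t ht u hu, ?_⟩
  have h1 := hasDerivAt_fderiv_along hBo hc.smoothX (hasDerivAt_line_x t u x) ⟨hx, ht, hu⟩
    (1, 0, 0)
  refine h1.unique (((hasDerivAt_rpow (hb.pos hx) (c - 1)).const_mul c).congr_of_eventuallyEq ?_)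
  filter_upwards [hb.openI.mem_nhds hx] with s hs using hXx s hs t ht u hu

/-- Take logarithms in `X_x² x^(2γ) = T_t X^(2 g(γ))`. Subtracting the relations for two values of
`γ` removes `X_x` and `T_t` and makes `log X` a constant multiple of `log x`. Substituting `X = x^c`
back makes `T_t` equal to `c²` times a power of `x`; as `T` involves only `t`, that power is
trivial, which determines `g`. -/
theorem exists_exponent (hb : IsBox I J K L M)
    (hΨ : IsEquivalenceTransformation (I ×ˢ J ×ˢ K ×ˢ L ×ˢ M) Ψ)
    (hc : HasCoordinates I J K L M Ψ X T U g) :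
    ∃ c ζ₀ : ℝ, c ≠ 0 ∧ (∀ γ ∈ L, g γ = 1 + (γ - 1) / c) ∧
      ∀ x ∈ I, ∀ t ∈ J, ∀ u ∈ K, X (x, t, u) = x ^ c ∧ T (x, t, u) = ζ₀ + c ^ 2 * t := by
  have hBo := hb.isOpen_base
  obtain ⟨t₀, ht₀⟩ := hb.connJ.nonempty
  obtain ⟨u₀, hu₀⟩ := hb.connK.nonempty
  obtain ⟨γ₁, hγ₁⟩ := hb.connL.nonempty
  obtain ⟨γ₂, hγ₂, hγ, -⟩ := exists_ne_ne_of_isOpen hb.openL hb.connL.nonempty γ₁ γ₁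
  obtain ⟨f₀, hf₀⟩ := hb.connM.nonempty
  have hXp : ∀ x ∈ I, ∀ t ∈ J, ∀ u ∈ K, 0 < X (x, t, u) := by
    intro x hx t ht u hu
    have h := hΨ.pos (x, t, u, γ₁, f₀) ⟨hx, ht, hu, hγ₁, hf₀⟩
    rwa [hc.eq x hx t ht u hu γ₁ hγ₁ f₀ hf₀] at h
  have hTp : ∀ x ∈ I, ∀ t ∈ J, ∀ u ∈ K, 0 < fderiv ℝ T (x, t, u) (0, 1, 0) := by
    intro x hx t ht u hu
    have hd := determining_equations hb hΨ hc (x := x) (t := t) (u := u) ⟨hx, ht, hu⟩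
    have h1 := (hd.2.2.2.2 γ₁ hγ₁).1
    have h2 := Real.rpow_pos_of_pos (hXp x hx t ht u hu) (2 * g γ₁)
    have h3 := Real.rpow_pos_of_pos (hb.pos hx) (2 * γ₁)
    have h4 : 0 < fderiv ℝ X (x, t, u) (1, 0, 0) ^ 2 := by have := hd.1; positivity
    have h5 := mul_pos h4 h3
    rw [h1] at h5
    exact pos_of_mul_pos_left h5 h2.le
  have hlog : ∀ x ∈ I, ∀ t ∈ J, ∀ u ∈ K, ∀ γ ∈ L,
      Real.log (fderiv ℝ X (x, t, u) (1, 0, 0) ^ 2) + 2 * γ * Real.log x =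
        Real.log (fderiv ℝ T (x, t, u) (0, 1, 0)) + 2 * g γ * Real.log (X (x, t, u)) := by
    intro x hx t ht u hu γ hγ
    have hd := determining_equations hb hΨ hc (x := x) (t := t) (u := u) ⟨hx, ht, hu⟩
    have hx0 : 0 < x := hb.pos hx
    have hX0 := hXp x hx t ht u hu
    have h := congrArg Real.log (hd.2.2.2.2 γ hγ).1
    rwa [Real.log_mul (pow_ne_zero 2 hd.1) (Real.rpow_pos_of_pos hx0 _).ne',
      Real.log_mul (hTp x hx t ht u hu).ne' (Real.rpow_pos_of_pos hX0 _).ne',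
      Real.log_rpow hx0, Real.log_rpow hX0] at h
  -- `x₁ ≠ 1` makes `log x₁` nonzero, so that `g` takes different values at `γ₁` and `γ₂`; the
  -- second abscissa `x₂ ≠ x₁` serves to compare `T_t` at two places.
  obtain ⟨x₁, hx₁, hx₁1, -⟩ := exists_ne_ne_of_isOpen hb.openI hb.connI.nonempty 1 1
  obtain ⟨x₂, hx₂, hx₂1, -⟩ := exists_ne_ne_of_isOpen hb.openI hb.connI.nonempty x₁ x₁
  have hx₁p : 0 < x₁ := hb.pos hx₁
  have hx₂p : 0 < x₂ := hb.pos hx₂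
  have hlx₁ : Real.log x₁ ≠ 0 := Real.log_ne_zero_of_pos_of_ne_one hx₁p hx₁1
  have hdiff : ∀ x ∈ I, ∀ t ∈ J, ∀ u ∈ K, ∀ γ ∈ L,
      (γ - γ₁) * Real.log x = (g γ - g γ₁) * Real.log (X (x, t, u)) := by
    intro x hx t ht u hu γ hγ
    have h1 := hlog x hx t ht u hu γ hγ
    have h2 := hlog x hx t ht u hu γ₁ hγ₁
    linarith
  have hg : g γ₂ - g γ₁ ≠ 0 := by
    intro h0
    have h := hdiff x₁ hx₁ t₀ ht₀ u₀ hu₀ γ₂ hγ₂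
    rw [h0, zero_mul] at h
    exact (mul_ne_zero (sub_ne_zero.2 hγ) hlx₁) h
  set c := (γ₂ - γ₁) / (g γ₂ - g γ₁) with hcdef
  have hc0 : c ≠ 0 := div_ne_zero (sub_ne_zero.2 hγ) hg
  have hlX : ∀ x ∈ I, ∀ t ∈ J, ∀ u ∈ K, Real.log (X (x, t, u)) = c * Real.log x := by
    intro x hx t ht u hu
    have h := hdiff x hx t ht u hu γ₂ hγ₂
    rw [hcdef, div_mul_eq_mul_div, eq_div_iff hg, h]
    ring
  have hX : ∀ x ∈ I, ∀ t ∈ J, ∀ u ∈ K, X (x, t, u) = x ^ c := by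
    intro x hx t ht u hu
    have hx0 : 0 < x := hb.pos hx
    rw [← Real.exp_log (hXp x hx t ht u hu), hlX x hx t ht u hu, Real.rpow_def_of_pos hx0, mul_comm]
  have hXx := fun x hx t ht u hu => (fderiv_X_of_eq_rpow hb hc hX x hx t ht u hu).1
  have hTconst : ∀ x ∈ I, ∀ t ∈ J, ∀ u ∈ K, T (x, t, u) = T (x₁, t, u₀) := by
    intro x hx t ht u hu
    have h1 : T (x, t, u) = T (x₁, t, u) :=
      eq_of_hasDerivAt_zero hb.openI hb.connI (h := fun s => T (s, t, u)) (fun a ha => by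
        have := hasDerivAt_along hBo hc.smoothT (hasDerivAt_line_x t u a) ⟨ha, ht, hu⟩
        rwa [(fderiv_T_x_u hb hΨ hc (y := (a, t, u)) ⟨ha, ht, hu⟩).1] at this) hx hx₁
    rw [h1]
    exact eq_of_hasDerivAt_zero hb.openK hb.connK (h := fun s => T (x₁, t, s)) (fun a ha => by
        have := hasDerivAt_along hBo hc.smoothT (hasDerivAt_line_u x₁ t a) ⟨hx₁, ht, ha⟩
        rwa [(fderiv_T_x_u hb hΨ hc (y := (x₁, t, a)) ⟨hx₁, ht, ha⟩).2] at this) hu hu₀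
  have hTt : ∀ t ∈ J, fderiv ℝ T (x₂, t, u₀) (0, 1, 0) = fderiv ℝ T (x₁, t, u₀) (0, 1, 0) := by
    intro t ht
    have h1 := hasDerivAt_along hBo hc.smoothT (hasDerivAt_line_t x₂ u₀ t) ⟨hx₂, ht, hu₀⟩
    have h2 := hasDerivAt_along hBo hc.smoothT (hasDerivAt_line_t x₁ u₀ t) ⟨hx₁, ht, hu₀⟩
    refine h1.unique (h2.congr_of_eventuallyEq ?_)
    filter_upwards [hb.openJ.mem_nhds ht] with s hs using hTconst x₂ hx₂ s hs u₀ hu₀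
  have hlog2 : ∀ x ∈ I, ∀ t ∈ J, ∀ γ ∈ L, Real.log (fderiv ℝ T (x, t, u₀) (0, 1, 0)) =
      Real.log (c ^ 2) + 2 * (c - 1 + γ - c * g γ) * Real.log x := by
    intro x hx t ht γ hγ
    have h := hlog x hx t ht u₀ hu₀ γ hγ
    have hx0 : 0 < x := hb.pos hx
    rw [hXx x hx t ht u₀ hu₀, hlX x hx t ht u₀ hu₀, mul_pow,
      Real.log_mul (pow_ne_zero 2 hc0) (pow_ne_zero 2 (Real.rpow_pos_of_pos hx0 _).ne'),
      Real.log_pow (x ^ (c - 1)), Real.log_rpow hx0] at h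
    push_cast at h
    linarith
  have hgγ : ∀ γ ∈ L, c - 1 + γ - c * g γ = 0 := by
    intro γ hγ
    have h1 := hlog2 x₁ hx₁ t₀ ht₀ γ hγ
    have h2 := hlog2 x₂ hx₂ t₀ ht₀ γ hγ
    rw [hTt t₀ ht₀] at h2
    have h3 : (c - 1 + γ - c * g γ) * (Real.log x₂ - Real.log x₁) = 0 := by linarith
    refine (mul_eq_zero.1 h3).resolve_right fun h => hx₂1 ?_
    exact Real.log_injOn_pos hx₂p hx₁p (sub_eq_zero.1 h)
  have hTc : ∀ t ∈ J, fderiv ℝ T (x₁, t, u₀) (0, 1, 0) = c ^ 2 := by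
    intro t ht
    have h1 := hlog2 x₁ hx₁ t ht γ₁ hγ₁
    rw [hgγ γ₁ hγ₁, mul_zero, zero_mul, add_zero] at h1
    exact Real.log_injOn_pos (hTp x₁ hx₁ t ht u₀ hu₀) (by simp; positivity) h1
  refine ⟨c, T (x₁, t₀, u₀) - c ^ 2 * t₀, hc0, fun γ hγ => ?_,
    fun x hx t ht u hu => ⟨hX x hx t ht u hu, ?_⟩⟩
  · have h := hgγ γ hγ
    field_simp
    linarith
  · rw [hTconst x hx t ht u hu]
    have := eq_of_hasDerivAt_zero hb.openJ hb.connJ (h := fun s => T (x₁, s, u₀) - c ^ 2 * s)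
      (fun a ha => by
        have h1 := hasDerivAt_along hBo hc.smoothT (hasDerivAt_line_t x₁ u₀ a) ⟨hx₁, ha, hu₀⟩
        rw [hTc a ha] at h1
        exact (h1.sub ((hasDerivAt_id a).const_mul (c ^ 2))).congr_deriv (by ring)) ht ht₀
    linarith

/-- `U_uu = 0` makes `U` affine in `u`. With `X = x^c`, the relation `2 U_xu X_x = U_u X_xx` says
that `x^(-(c-1)/2) U_u` is constant in `x`; this constant is `ζ₁`, and `F` collects what is left at
`u₀`. -/
theorem exists_affine (hb : IsBox I J K L M)
    (hΨ : IsEquivalenceTransformation (I ×ˢ J ×ˢ K ×ˢ L ×ˢ M) Ψ)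
    (hc : HasCoordinates I J K L M Ψ X T U g) {c : ℝ} (hc0 : c ≠ 0)
    (hX : ∀ x ∈ I, ∀ t ∈ J, ∀ u ∈ K, X (x, t, u) = x ^ c) :
    ∃ (ζ₁ : ℝ) (F : ℝ → ℝ), ζ₁ ≠ 0 ∧ ContDiffOn ℝ ∞ F I ∧
      ∀ x ∈ I, ∀ t ∈ J, ∀ u ∈ K, U (x, t, u) = x ^ ((c - 1) / 2) * (ζ₁ * u + F x) := by
  have hBo := hb.isOpen_base
  obtain ⟨x₀, hx₀⟩ := hb.connI.nonempty
  obtain ⟨t₀, ht₀⟩ := hb.connJ.nonempty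
  obtain ⟨u₀, hu₀⟩ := hb.connK.nonempty
  have hXx := fun x hx t ht u hu => (fderiv_X_of_eq_rpow hb hc hX x hx t ht u hu).1
  have hXxx := fun x hx t ht u hu => (fderiv_X_of_eq_rpow hb hc hX x hx t ht u hu).2
  have hUt : ∀ x ∈ I, ∀ t ∈ J, ∀ u ∈ K, U (x, t, u) = U (x, t₀, u) := by
    intro x hx t ht u hu
    exact eq_of_hasDerivAt_zero hb.openJ hb.connJ (h := fun s => U (x, s, u)) (fun a ha => by
        have := hasDerivAt_along hBo hc.smoothU (hasDerivAt_line_t x u a) ⟨hx, ha, hu⟩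
        rwa [(fderiv_t hb hΨ hc (y := (x, a, u)) ⟨hx, ha, hu⟩).2.1] at this) ht ht₀
  have hUu : ∀ x ∈ I, ∀ u ∈ K,
      fderiv ℝ U (x, t₀, u) (0, 0, 1) = fderiv ℝ U (x, t₀, u₀) (0, 0, 1) := by
    intro x hx u hu
    exact eq_of_hasDerivAt_zero hb.openK hb.connK
      (h := fun s => fderiv ℝ U (x, t₀, s) (0, 0, 1)) (fun a ha => by
        have := hasDerivAt_fderiv_along hBo hc.smoothU (hasDerivAt_line_u x t₀ a) ⟨hx, ht₀, ha⟩
          (0, 0, 1)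
        rwa [(determining_equations hb hΨ hc (x := x) (t := t₀) (u := a)
          ⟨hx, ht₀, ha⟩).2.2.1] at this) hu hu₀
  set m := (c - 1) / 2 with hm
  set ζ₁ := x₀ ^ (-m) * fderiv ℝ U (x₀, t₀, u₀) (0, 0, 1) with hζ₁
  have hUx : ∀ x ∈ I, fderiv ℝ U (x, t₀, u₀) (0, 0, 1) = x ^ m * ζ₁ := by
    intro x hx
    have h := eq_of_hasDerivAt_zero hb.openI hb.connI
      (h := fun s => s ^ (-m) * fderiv ℝ U (s, t₀, u₀) (0, 0, 1)) (fun a ha => by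
        have ha0 : 0 < a := hb.pos ha
        have h1 := hasDerivAt_fderiv_along hBo hc.smoothU (hasDerivAt_line_x t₀ u₀ a)
          ⟨ha, ht₀, hu₀⟩ (0, 0, 1)
        refine ((hasDerivAt_rpow ha0 (-m)).mul h1).congr_deriv ?_
        have h2 := (determining_equations hb hΨ hc (x := a) (t := t₀) (u := u₀)
          ⟨ha, ht₀, hu₀⟩).2.2.2.1
        rw [hXx a ha t₀ ht₀ u₀ hu₀, hXxx a ha t₀ ht₀ u₀ hu₀, Real.rpow_sub_one ha0.ne' (c - 1)] at h2
        rw [Real.rpow_sub_one ha0.ne' (-m)]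
        have hP := (Real.rpow_pos_of_pos ha0 (c - 1)).ne'
        have h3 : fderiv ℝ (fderiv ℝ U) (a, t₀, u₀) (1, 0, 0) (0, 0, 1) =
            fderiv ℝ U (a, t₀, u₀) (0, 0, 1) * m / a := by
          have ha1 := ha0.ne'
          rw [hm]
          field_simp at h2 ⊢
          linarith
        rw [h3]
        ring) hx hx₀
    have hx0 : 0 < x := hb.pos hx
    rw [← hζ₁, Real.rpow_neg hx0.le] at h
    have := (Real.rpow_pos_of_pos hx0 m).ne'
    rw [← h]
    field_simp
  have hU : ∀ x ∈ I, ∀ u ∈ K, U (x, t₀, u) = U (x, t₀, u₀) + x ^ m * ζ₁ * (u - u₀) := by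
    intro x hx u hu
    have h := eq_of_hasDerivAt_zero hb.openK hb.connK
      (h := fun s => U (x, t₀, s) - x ^ m * ζ₁ * s) (fun a ha => by
        have h1 := hasDerivAt_along hBo hc.smoothU (hasDerivAt_line_u x t₀ a) ⟨hx, ht₀, ha⟩
        rw [hUu x hx a ha, hUx x hx] at h1
        exact (h1.sub ((hasDerivAt_id a).const_mul (x ^ m * ζ₁))).congr_deriv (by ring)) hu hu₀
    linarith
  refine ⟨ζ₁, fun x => x ^ (-m) * U (x, t₀, u₀) - ζ₁ * u₀, ?_, ?_, ?_⟩
  · have h1 := (determining_equations hb hΨ hc (x := x₀) (t := t₀) (u := u₀)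
      ⟨hx₀, ht₀, hu₀⟩).2.1
    exact mul_ne_zero (Real.rpow_pos_of_pos (hb.pos hx₀) _).ne' h1
  · have h1 : ContDiffOn ℝ ∞ (fun x : ℝ => U (x, t₀, u₀)) I :=
      hc.smoothU.comp (contDiff_id.prodMk contDiff_const).contDiffOn fun x hx => ⟨hx, ht₀, hu₀⟩
    have h2 : ContDiffOn ℝ ∞ (fun x : ℝ => x ^ (-m)) I := fun x hx =>
      (contDiffAt_id.rpow_const_of_ne (ne_of_gt (hb.pos hx))).contDiffWithinAt
    exact (h2.mul h1).sub contDiffOn_const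
  · intro x hx t ht u hu
    have hx0 : 0 < x := hb.pos hx
    have := (Real.rpow_pos_of_pos hx0 m).ne'
    rw [hUt x hx t ht u hu, hU x hx u hu]
    dsimp only
    rw [Real.rpow_neg hx0.le]
    field_simp
    ring

/-- Every equivalence transformation over a box is one of the maps `powerMap`. -/
theorem exists_powerMap (hb : IsBox I J K L M)
    (hΨ : IsEquivalenceTransformation (I ×ˢ J ×ˢ K ×ˢ L ×ˢ M) Ψ) :
    ∃ (c ζ₀ ζ₁ : ℝ) (F : ℝ → ℝ), c ≠ 0 ∧ ζ₁ ≠ 0 ∧ ContDiffOn ℝ ∞ F I ∧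
      EqOn Ψ (powerMap c ζ₀ ζ₁ F) (I ×ˢ J ×ˢ K ×ˢ L ×ˢ M) := by
  have hBo := hb.isOpen_base
  obtain ⟨X, T, U, g, hc⟩ := exists_coordinates hb hΨ
  obtain ⟨c, ζ₀, hc0, hg, hXT⟩ := exists_exponent hb hΨ hc
  have hX := fun x hx t ht u hu => (hXT x hx t ht u hu).1
  obtain ⟨ζ₁, F, hζ₁, hF, hU⟩ := exists_affine hb hΨ hc hc0 hX
  refine ⟨c, ζ₀, ζ₁, F, hc0, hζ₁, hF, ?_⟩
  rintro ⟨x, t, u, γ, f⟩ ⟨hx, ht, hu, hγ, hf⟩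
  dsimp only at hx ht hu hγ hf
  obtain ⟨hXx, hXxx⟩ := fderiv_X_of_eq_rpow hb hc hX x hx t ht u hu
  set m := (c - 1) / 2 with hm
  have hF1 : ∀ x ∈ I, HasDerivAt F (deriv F x) x := fun x hx =>
    ((hF.contDiffAt (hb.openI.mem_nhds hx)).differentiableAt (by simp)).hasDerivAt
  have hF2 : HasDerivAt (deriv F) (iteratedDeriv 2 F x) x := by
    rw [iteratedDeriv_two]
    exact ((hF.contDiffAt (hb.openI.mem_nhds hx)).deriv_infty.differentiableAt
      (by simp)).hasDerivAt
  have hUx : ∀ x ∈ I, fderiv ℝ U (x, t, u) (1, 0, 0) =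
      m * x ^ (m - 1) * (ζ₁ * u + F x) + x ^ m * deriv F x := by
    intro x hx
    have h1 := hasDerivAt_along hBo hc.smoothU (hasDerivAt_line_x t u x) ⟨hx, ht, hu⟩
    refine h1.unique (((hasDerivAt_rpow (hb.pos hx) m).mul
      ((hF1 x hx).const_add (ζ₁ * u))).congr_of_eventuallyEq ?_)
    filter_upwards [hb.openI.mem_nhds hx] with s hs using hU s hs t ht u hu
  have hUxx : fderiv ℝ (fderiv ℝ U) (x, t, u) (1, 0, 0) (1, 0, 0) =
      m * (m - 1) * x ^ (m - 2) * (ζ₁ * u + F x) + 2 * (m * x ^ (m - 1)) * deriv F x +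
        x ^ m * iteratedDeriv 2 F x := by
    have h1 := hasDerivAt_fderiv_along hBo hc.smoothU (hasDerivAt_line_x t u x) ⟨hx, ht, hu⟩
      (1, 0, 0)
    have h2 := ((((hasDerivAt_rpow (hb.pos hx) (m - 1)).const_mul m).mul
      ((hF1 x hx).const_add (ζ₁ * u))).add ((hasDerivAt_rpow (hb.pos hx) m).mul hF2))
    refine (h1.unique (h2.congr_of_eventuallyEq ?_)).trans ?_
    · filter_upwards [hb.openI.mem_nhds hx] with s hs using hUx s hs
    · rw [show m - 1 - 1 = m - 2 by ring]
      ring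
  have hUu : fderiv ℝ U (x, t, u) (0, 0, 1) = x ^ m * ζ₁ := by
    have h1 := hasDerivAt_along hBo hc.smoothU (hasDerivAt_line_u x t u) ⟨hx, ht, hu⟩
    have h2 := ((((hasDerivAt_id u).const_mul ζ₁).add_const (F x)).const_mul (x ^ m))
    refine (h1.unique (h2.congr_of_eventuallyEq ?_)).trans (by ring)
    filter_upwards [hb.openK.mem_nhds hu] with s hs using hU x hx t ht s hs
  -- With `X`, `T`, `U`, `g` known, the last determining equation is solved for the new `f`.
  have hΦ := ((determining_equations hb hΨ hc (x := x) (t := t) (u := u)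
    ⟨hx, ht, hu⟩).2.2.2.2 γ hγ).2 f hf
  rw [hXx, hXxx, hUx x hx, hUxx, hUu, hX x hx t ht u hu, hg γ hγ] at hΦ
  have hf' := transformed_f_eq (hb.pos hx) hc0 hΦ
  rw [hc.eq x hx t ht u hu γ hγ f hf, hX x hx t ht u hu, (hXT x hx t ht u hu).2,
    hU x hx t ht u hu, hg γ hγ, hf']
  rfl

end IsEquivalenceTransformation

/-! ### Inverse and smoothness of the power maps. -/

/-- The point with `x`-coordinate `x` that `powerMap` sends to `z`, if `z.x = x ^ c`. -/
noncomputable def powerMapSolve (c ζ₀ ζ₁ : ℝ) (F : ℝ → ℝ) (x : ℝ) (z : ExtSpace) : ExtSpace :=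
  (x,
   (z.t - ζ₀) / c ^ 2,
   (x ^ (-((c - 1) / 2)) * z.u - F x) / ζ₁,
   1 + c * (z.γ - 1),
   ((4 * x ^ (-((c - 5) / 2)) * z.f
     - (1 / c ^ 2 - 1) * x ^ (2 * (1 + c * (z.γ - 1))) * (x ^ (-((c - 1) / 2)) * z.u))
      * (c ^ 2 / (4 * x ^ 2)) - x ^ (2 * (1 + c * (z.γ - 1))) * iteratedDeriv 2 F x) / ζ₁)

/-- Passing the old `x` separately, rather than as a root of the new one, leaves only powers of a
single base, which become atoms of a rational identity. -/
theorem powerMapSolve_powerMap {c ζ₁ : ℝ} (hc : c ≠ 0) (hζ₁ : ζ₁ ≠ 0) (ζ₀ : ℝ) (F : ℝ → ℝ)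
    {z : ExtSpace} (hz : 0 < z.x) :
    powerMapSolve c ζ₀ ζ₁ F z.x (powerMap c ζ₀ ζ₁ F z) = z := by
  obtain ⟨x, t, u, γ, f⟩ := z
  change 0 < x at hz
  have hγ : 1 + c * (1 + (γ - 1) / c - 1) = γ := by field_simp; ring
  simp only [powerMapSolve, powerMap, ExtSpace.x, ExtSpace.t, ExtSpace.u, ExtSpace.γ, ExtSpace.f, hγ,
    Real.rpow_neg hz.le]
  have h1 := (Real.rpow_pos_of_pos hz ((c - 1) / 2)).ne'
  have h2 := (Real.rpow_pos_of_pos hz ((c - 5) / 2)).ne'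
  have hx := hz.ne'
  generalize x ^ ((c - 1) / 2) = Q at *
  generalize x ^ ((c - 5) / 2) = S at *
  generalize x ^ (2 * γ) = R at *
  refine Prod.ext rfl (Prod.ext ?_ (Prod.ext ?_ (Prod.ext rfl ?_)))
  · field_simp; ring
  · field_simp; ring
  · field_simp; ring

theorem powerMap_powerMapSolve {c ζ₁ : ℝ} (hc : c ≠ 0) (hζ₁ : ζ₁ ≠ 0) (ζ₀ : ℝ) (F : ℝ → ℝ)
    {x : ℝ} (hx : 0 < x) {z : ExtSpace} (hz : x ^ c = z.x) :
    powerMap c ζ₀ ζ₁ F (powerMapSolve c ζ₀ ζ₁ F x z) = z := by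
  obtain ⟨X, t, u, γ, f⟩ := z
  change x ^ c = X at hz
  simp only [powerMapSolve, powerMap, ExtSpace.x, ExtSpace.t, ExtSpace.u, ExtSpace.γ, ExtSpace.f,
    Real.rpow_neg hx.le]
  have h1 := (Real.rpow_pos_of_pos hx ((c - 1) / 2)).ne'
  have h2 := (Real.rpow_pos_of_pos hx ((c - 5) / 2)).ne'
  have hx' := hx.ne'
  generalize x ^ ((c - 1) / 2) = Q at *
  generalize x ^ ((c - 5) / 2) = S at *
  generalize x ^ (2 * (1 + c * (γ - 1))) = R at *
  refine Prod.ext hz (Prod.ext ?_ (Prod.ext ?_ (Prod.ext ?_ ?_)))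
  · field_simp; ring
  · field_simp; ring
  · field_simp; ring
  · field_simp; ring

theorem ContDiffWithinAt.rpow_of_pos {E : Type*} [NormedAddCommGroup E] [NormedSpace ℝ E]
    {f g : E → ℝ} {s : Set E} {a : E} (hf : ContDiffWithinAt ℝ ∞ f s a)
    (hg : ContDiffWithinAt ℝ ∞ g s a) (h : 0 < f a) :
    ContDiffWithinAt ℝ ∞ (fun y => f y ^ g y) s a :=
  hf.rpow hg h.ne'

theorem ContDiffOn.iteratedDeriv_two {F : ℝ → ℝ} {I : Set ℝ} (hI : IsOpen I)
    (hF : ContDiffOn ℝ ∞ F I) : ContDiffOn ℝ ∞ (iteratedDeriv 2 F) I := by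
  rw [_root_.iteratedDeriv_two]
  exact fun x hx => (hF.contDiffAt (hI.mem_nhds hx)).deriv_infty.deriv_infty.contDiffWithinAt

theorem ContDiff.ext_coordinates :
    ContDiff ℝ ∞ ExtSpace.x ∧ ContDiff ℝ ∞ ExtSpace.t ∧ ContDiff ℝ ∞ ExtSpace.u ∧
      ContDiff ℝ ∞ ExtSpace.γ ∧ ContDiff ℝ ∞ ExtSpace.f :=
  ⟨contDiff_fst, contDiff_snd.fst, contDiff_snd.snd.fst, contDiff_snd.snd.snd.fst,
    contDiff_snd.snd.snd.snd⟩

/-- `powerMap` depends smoothly on all variables and parameters. -/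
theorem ContDiffWithinAt.powerMap {E : Type*} [NormedAddCommGroup E] [NormedSpace ℝ E]
    {c ζ₀ ζ₁ σ : E → ℝ} {z : E → ExtSpace} {s : Set E} {a : E} (hc : ContDiffWithinAt ℝ ∞ c s a)
    (hζ₀ : ContDiffWithinAt ℝ ∞ ζ₀ s a) (hζ₁ : ContDiffWithinAt ℝ ∞ ζ₁ s a)
    (hσ : ContDiffWithinAt ℝ ∞ σ s a) (hz : ContDiffWithinAt ℝ ∞ z s a) (hca : c a ≠ 0)
    {F : ℝ → ℝ} {I : Set ℝ} (hI : IsOpen I) (hF : ContDiffOn ℝ ∞ F I) (hzI : (z a).x ∈ I)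
    (hz0 : 0 < (z a).x) :
    ContDiffWithinAt ℝ ∞
      (fun y => _root_.powerMap (c y) (ζ₀ y) (ζ₁ y) (fun x => σ y * F x) (z y)) s a := by
  obtain ⟨hx, ht, hu, hγ, hf⟩ := ContDiff.ext_coordinates
  have hx := hx.contDiffAt.comp_contDiffWithinAt a hz
  have ht := ht.contDiffAt.comp_contDiffWithinAt a hz
  have hu := hu.contDiffAt.comp_contDiffWithinAt a hz
  have hγ := hγ.contDiffAt.comp_contDiffWithinAt a hz
  have hf := hf.contDiffAt.comp_contDiffWithinAt a hz
  have hFx : ContDiffWithinAt ℝ ∞ (fun y => σ y * F (z y).x) s a :=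
    hσ.mul (ContDiffAt.comp_contDiffWithinAt (g := F) a (hF.contDiffAt (hI.mem_nhds hzI)) hx)
  have hFxx : ContDiffWithinAt ℝ ∞
      (fun y => iteratedDeriv 2 (fun x => σ y * F x) (z y).x) s a := by
    simp only [iteratedDeriv_const_mul_field]
    exact hσ.mul (ContDiffAt.comp_contDiffWithinAt (g := iteratedDeriv 2 F) a
      ((hF.iteratedDeriv_two hI).contDiffAt (hI.mem_nhds hzI)) hx)
  have hk : ∀ k : ℝ, ContDiffWithinAt ℝ ∞ (fun _ : E => k) s a := fun _ => contDiffWithinAt_const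
  have hw := (hζ₁.mul hu).add hFx
  have hR := hx.rpow_of_pos ((hk 2).mul hγ) hz0
  have hc2 : c a ^ 2 ≠ 0 := pow_ne_zero 2 hca
  exact (hx.rpow_of_pos hc hz0).prodMk ((hζ₀.add ((hc.pow 2).mul ht)).prodMk
    (((hx.rpow_of_pos ((hc.sub (hk 1)).div_const 2) hz0).mul hw).prodMk
    (((hk 1).add ((hγ.sub (hk 1)).div hc hca)).prodMk
    (((hk _).mul (hx.rpow_of_pos ((hc.sub (hk 5)).div_const 2) hz0)).mul
      ((((((hk 1).div (hc.pow 2) hc2).sub (hk 1)).mul hR).mul hw).add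
      ((((hk 4).div (hc.pow 2) hc2).mul (hx.pow 2)).mul ((hζ₁.mul hf).add (hR.mul hFxx))))))))

theorem contDiffOn_powerMap {c : ℝ} (hc : c ≠ 0) (ζ₀ ζ₁ : ℝ) {F : ℝ → ℝ} {I : Set ℝ}
    (hI : IsOpen I) (hpos : I ⊆ Ioi 0) (hF : ContDiffOn ℝ ∞ F I) {D : Set ExtSpace}
    (hD : ∀ z ∈ D, z.x ∈ I) : ContDiffOn ℝ ∞ (powerMap c ζ₀ ζ₁ F) D := by
  intro z hz
  have h := ContDiffWithinAt.powerMap (s := D) (a := z) (z := id) (c := fun _ => c)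
    (ζ₀ := fun _ => ζ₀) (ζ₁ := fun _ => ζ₁) (σ := fun _ => 1) contDiffWithinAt_const
    contDiffWithinAt_const contDiffWithinAt_const contDiffWithinAt_const contDiffWithinAt_id hc hI hF
    (hD z hz) (hpos (hD z hz))
  simpa only [one_mul, id] using h

theorem contDiffOn_powerMapSolve (c ζ₀ ζ₁ : ℝ) {F : ℝ → ℝ} {I : Set ℝ} (hI : IsOpen I)
    (hpos : I ⊆ Ioi 0) (hF : ContDiffOn ℝ ∞ F I) :
    ContDiffOn ℝ ∞ (fun z : ExtSpace => powerMapSolve c ζ₀ ζ₁ F (z.x ^ (1 / c)) z)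
      {z | 0 < z.x ∧ z.x ^ (1 / c) ∈ I} := by
  obtain ⟨hx, ht, hu, hγ, hf⟩ := ContDiff.ext_coordinates
  set D : Set ExtSpace := {z | 0 < z.x ∧ z.x ^ (1 / c) ∈ I}
  rintro z hz
  have hz1 : 0 < z.x ^ (1 / c) := hpos hz.2
  have hx := (hx.contDiffWithinAt (s := D) (x := z)).rpow_of_pos
    (contDiffWithinAt_const (c := 1 / c)) hz.1
  have ht := ht.contDiffWithinAt (s := D) (x := z)
  have hu := hu.contDiffWithinAt (s := D) (x := z)
  have hγ := hγ.contDiffWithinAt (s := D) (x := z)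
  have hf := hf.contDiffWithinAt (s := D) (x := z)
  have hFx : ContDiffWithinAt ℝ ∞ (fun z : ExtSpace => F (z.x ^ (1 / c))) D z :=
    (hF.contDiffAt (hI.mem_nhds hz.2)).comp_contDiffWithinAt z hx
  have hFxx : ContDiffWithinAt ℝ ∞ (fun z : ExtSpace => iteratedDeriv 2 F (z.x ^ (1 / c))) D z :=
    ContDiffAt.comp_contDiffWithinAt (g := iteratedDeriv 2 F) z
      ((hF.iteratedDeriv_two hI).contDiffAt (hI.mem_nhds hz.2)) hx
  have hw := (hx.rpow_of_pos (contDiffWithinAt_const (c := -((c - 1) / 2))) hz1).mul hu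
  have hγ' := contDiffWithinAt_const (c := (1 : ℝ)) |>.add (contDiffWithinAt_const (c := c) |>.mul
    (hγ.sub (contDiffWithinAt_const (c := (1 : ℝ)))))
  have hR := hx.rpow_of_pos (contDiffWithinAt_const (c := (2 : ℝ)) |>.mul hγ') hz1
  refine hx.prodMk (((ht.sub contDiffWithinAt_const).div_const _).prodMk
    (((hw.sub hFx).div_const _).prodMk (hγ'.prodMk
    ((((((contDiffWithinAt_const.mul (hx.rpow_of_pos contDiffWithinAt_const hz1)).mul hf).sub
      ((contDiffWithinAt_const.mul hR).mul hw)).mul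
      (contDiffWithinAt_const.div (contDiffWithinAt_const.mul (hx.pow 2)) ?_)).sub
      (hR.mul hFxx)).div_const _))))
  positivity

/-! ### Power maps preserve the class. -/

/-- The left-hand side of the equation is multiplied by a nonvanishing factor. -/
theorem equation_transform {c γ ζ₁ x w w₁ F₂ q₂ f uₜ vₜ p₁ p₂ : ℝ} (hx : 0 < x) (hc : c ≠ 0)
    (ht : vₜ * c ^ 2 = x ^ ((c - 1) / 2) * (ζ₁ * uₜ))
    (h1 : p₁ * (c * x ^ (c - 1)) =
      ((c - 1) / 2) * x ^ ((c - 1) / 2 - 1) * w + x ^ ((c - 1) / 2) * w₁)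
    (h2 : p₂ * (c * x ^ (c - 1)) * (c * x ^ (c - 1)) + p₁ * (c * ((c - 1) * x ^ (c - 1 - 1))) =
      ((c - 1) / 2) * (((c - 1) / 2 - 1) * x ^ ((c - 1) / 2 - 1 - 1)) * w +
        ((c - 1) / 2) * x ^ ((c - 1) / 2 - 1) * w₁ +
        (((c - 1) / 2) * x ^ ((c - 1) / 2 - 1) * w₁ + x ^ ((c - 1) / 2) * (ζ₁ * q₂ + F₂))) :
    vₜ + (x ^ c) ^ (2 * (1 + (γ - 1) / c)) * p₂ -
      (1 / 4 : ℝ) * x ^ ((c - 5) / 2) *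
      ((1 / c ^ 2 - 1) * x ^ (2 * γ) * w + 4 / c ^ 2 * x ^ 2 * (ζ₁ * f + x ^ (2 * γ) * F₂)) =
    x ^ ((c - 1) / 2) * ζ₁ / c ^ 2 * (uₜ + x ^ (2 * γ) * q₂ - f) := by
  have hP : 0 < x ^ (c - 1) := Real.rpow_pos_of_pos hx _
  have e1 : (x ^ c) ^ (2 * (1 + (γ - 1) / c)) = x ^ (2 * γ) * (x ^ (c - 1)) ^ 2 := by
    rw [← Real.rpow_mul hx.le, ← Real.rpow_natCast (x ^ (c - 1)), ← Real.rpow_mul hx.le,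
      ← Real.rpow_add hx]
    congr 1
    field_simp
    push_cast
    ring
  have e2 : x ^ ((c - 1) / 2 - 1) = x ^ ((c - 1) / 2) / x := by rw [Real.rpow_sub_one hx.ne']
  have e3 : x ^ ((c - 1) / 2 - 1 - 1) = x ^ ((c - 1) / 2) / x ^ 2 := by
    rw [Real.rpow_sub_one hx.ne', e2, div_div, pow_two]
  have e4 : x ^ ((c - 5) / 2) = x ^ ((c - 1) / 2) / x ^ 2 := by
    rw [← e3]; congr 1; ring
  have e5 : x ^ (c - 1 - 1) = x ^ (c - 1) / x := by rw [Real.rpow_sub_one hx.ne']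
  rw [e1, e4]
  rw [e2] at h1
  rw [e2, e3, e5] at h2
  have hx0 := hx.ne'
  have hP0 := hP.ne'
  generalize x ^ (c - 1) = P at *
  generalize x ^ (2 * γ) = R at *
  generalize x ^ ((c - 1) / 2) = Q at *
  have hp₁ : p₁ = ((c - 1) / 2 * (Q / x) * w + Q * w₁) / (c * P) :=
    eq_div_of_mul_eq (mul_ne_zero hc hP0) h1
  have hvt : vₜ = Q * (ζ₁ * uₜ) / c ^ 2 := eq_div_of_mul_eq (pow_ne_zero 2 hc) ht
  have hp₂ : P ^ 2 * p₂ = ((c - 1) / 2 * (((c - 1) / 2 - 1) * (Q / x ^ 2)) * w +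
      (c - 1) / 2 * (Q / x) * w₁ + ((c - 1) / 2 * (Q / x) * w₁ + Q * (ζ₁ * q₂ + F₂)) -
      p₁ * (c * ((c - 1) * (P / x)))) / c ^ 2 := by
    rw [eq_div_iff (pow_ne_zero 2 hc)]
    linear_combination h2
  rw [mul_assoc R, hp₂, hp₁, hvt]
  field_simp
  ring

/-- The chain rule, applied to `hval` once in `t` and twice in `x`, supplies the inputs of
`equation_transform`, so the two left-hand sides differ by a nonvanishing factor at corresponding
points. The new element matters only on the graph of the solution. -/
theorem isSolutionOn_iff_of_transform {c ζ₀ ζ₁ γ : ℝ} (hc : c ≠ 0) (hζ₁ : ζ₁ ≠ 0) {F : ℝ → ℝ}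
    {I : Set ℝ} (hI : IsOpen I) (hpos : I ⊆ Ioi 0) (hF : ContDiffOn ℝ ∞ F I)
    {W W' : Set (ℝ × ℝ)} {u v f f' : ℝ → ℝ → ℝ} (hW : IsOpen W) (hW' : IsOpen W')
    (hu : ContDiffOn ℝ ∞ (Function.uncurry u) W) (hv : ContDiffOn ℝ ∞ (Function.uncurry v) W')
    (hWI : ∀ x t, (x, t) ∈ W → x ∈ I)
    (hmaps : ∀ x t, (x, t) ∈ W → (x ^ c, ζ₀ + c ^ 2 * t) ∈ W')
    (hsurj : ∀ a b, (a, b) ∈ W' → ∃ x t, (x, t) ∈ W ∧ a = x ^ c ∧ b = ζ₀ + c ^ 2 * t)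
    (hval : ∀ x t, (x, t) ∈ W →
      v (x ^ c) (ζ₀ + c ^ 2 * t) = x ^ ((c - 1) / 2) * (ζ₁ * u x t + F x))
    (hf : ∀ x t, (x, t) ∈ W →
      f' (x ^ c) (v (x ^ c) (ζ₀ + c ^ 2 * t)) = (1 / 4 : ℝ) * x ^ ((c - 5) / 2) *
        ((1 / c ^ 2 - 1) * x ^ (2 * γ) * (ζ₁ * u x t + F x)
          + 4 / c ^ 2 * x ^ 2 * (ζ₁ * f x (u x t) + x ^ (2 * γ) * iteratedDeriv 2 F x))) :
    IsSolutionOn γ f W u ↔ IsSolutionOn (1 + (γ - 1) / c) f' W' v := by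
  have key : ∀ x t, (x, t) ∈ W →
      deriv (fun s => v (x ^ c) s) (ζ₀ + c ^ 2 * t) + (x ^ c) ^ (2 * (1 + (γ - 1) / c)) *
        iteratedDeriv 2 (fun y => v y (ζ₀ + c ^ 2 * t)) (x ^ c) -
        f' (x ^ c) (v (x ^ c) (ζ₀ + c ^ 2 * t)) =
      x ^ ((c - 1) / 2) * ζ₁ / c ^ 2 * (deriv (fun s => u x s) t +
        x ^ (2 * γ) * iteratedDeriv 2 (fun y => u y t) x - f x (u x t)) := by
    intro x t hxt
    have hxI := hWI x t hxt
    have hx : 0 < x := hpos hxI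
    have hut : ContDiffAt ℝ ∞ (fun s => u x s) t :=
      (hu.contDiffAt (hW.mem_nhds hxt)).comp t (contDiffAt_const.prodMk contDiffAt_id)
    have hvt : ContDiffAt ℝ ∞ (fun s => v (x ^ c) s) (ζ₀ + c ^ 2 * t) :=
      (hv.contDiffAt (hW'.mem_nhds (hmaps x t hxt))).comp _
        (contDiffAt_const.prodMk contDiffAt_id)
    have hux : ∀ y, (y, t) ∈ W → ContDiffAt ℝ ∞ (fun y => u y t) y := fun y hy =>
      (hu.contDiffAt (hW.mem_nhds hy)).comp y (contDiffAt_id.prodMk contDiffAt_const)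
    have hvx : ∀ y, (y, t) ∈ W → ContDiffAt ℝ ∞ (fun y => v y (ζ₀ + c ^ 2 * t)) (y ^ c) :=
      fun y hy => ContDiffAt.comp (g := Function.uncurry v) (y ^ c)
        (hv.contDiffAt (hW'.mem_nhds (hmaps y t hy))) (contDiffAt_id.prodMk contDiffAt_const)
    have hFx : ∀ y, (y, t) ∈ W → ContDiffAt ℝ ∞ F y := fun y hy =>
      hF.contDiffAt (hI.mem_nhds (hWI y t hy))
    have hevt : ∀ᶠ s in nhds t, (x, s) ∈ W :=
      (continuousAt_const.prodMk continuousAt_id).eventually_mem (hW.mem_nhds hxt)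
    have hevx : ∀ᶠ y in nhds x, (y, t) ∈ W :=
      (continuousAt_id.prodMk continuousAt_const).eventually_mem (hW.mem_nhds hxt)
    have ht : deriv (fun s => v (x ^ c) s) (ζ₀ + c ^ 2 * t) * c ^ 2 =
        x ^ ((c - 1) / 2) * (ζ₁ * deriv (fun s => u x s) t) := by
      have h1 : HasDerivAt (fun s => ζ₀ + c ^ 2 * s) (c ^ 2) t := by
        simpa using ((hasDerivAt_id t).const_mul (c ^ 2)).const_add ζ₀
      have h2 := HasDerivAt.comp t (hvt.differentiableAt (by simp)).hasDerivAt h1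
      have h3 := (((hut.differentiableAt (by simp)).hasDerivAt.const_mul ζ₁).add_const
        (F x)).const_mul (x ^ ((c - 1) / 2))
      exact h2.unique (h3.congr_of_eventuallyEq (hevt.mono fun s hs => hval x s hs))
    have hd1 : ∀ y, (y, t) ∈ W →
        deriv (fun y => v y (ζ₀ + c ^ 2 * t)) (y ^ c) * (c * y ^ (c - 1)) =
        ((c - 1) / 2) * y ^ ((c - 1) / 2 - 1) * (ζ₁ * u y t + F y) +
          y ^ ((c - 1) / 2) * (ζ₁ * deriv (fun y => u y t) y + deriv F y) := by
      intro y hy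
      have hy0 : 0 < y := hpos (hWI y t hy)
      have h2 := HasDerivAt.comp y ((hvx y hy).differentiableAt (by simp)).hasDerivAt
        (hasDerivAt_rpow hy0 c)
      have h3 := (hasDerivAt_rpow hy0 ((c - 1) / 2)).mul
        ((((hux y hy).differentiableAt (by simp)).hasDerivAt.const_mul ζ₁).add
          ((hFx y hy).differentiableAt (by simp)).hasDerivAt)
      refine h2.unique (h3.congr_of_eventuallyEq ?_)
      have : ∀ᶠ s in nhds y, (s, t) ∈ W :=
        (continuousAt_id.prodMk continuousAt_const).eventually_mem (hW.mem_nhds hy)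
      exact this.mono fun s hs => hval s t hs
    rw [hf x t hxt]
    refine equation_transform hx hc ht (hd1 x hxt) ?_
    rw [iteratedDeriv_two, iteratedDeriv_two, iteratedDeriv_two]
    have h2 := (HasDerivAt.comp x ((hvx x hxt).deriv_infty.differentiableAt (by simp)).hasDerivAt
      (hasDerivAt_rpow hx c)).mul ((hasDerivAt_rpow hx (c - 1)).const_mul c)
    have h3 := (((hasDerivAt_rpow hx ((c - 1) / 2 - 1)).const_mul ((c - 1) / 2)).mul
        ((((hux x hxt).differentiableAt (by simp)).hasDerivAt.const_mul ζ₁).add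
          ((hFx x hxt).differentiableAt (by simp)).hasDerivAt)).add
      ((hasDerivAt_rpow hx ((c - 1) / 2)).mul
        ((((hux x hxt).deriv_infty.differentiableAt (by simp)).hasDerivAt.const_mul ζ₁).add
          ((hFx x hxt).deriv_infty.differentiableAt (by simp)).hasDerivAt))
    exact h2.unique (h3.congr_of_eventuallyEq (hevx.mono fun y hy => hd1 y hy))
  constructor
  · rintro ⟨-, h⟩
    refine ⟨hv, fun a b hab => ?_⟩
    obtain ⟨x, t, hxt, rfl, rfl⟩ := hsurj a b hab
    rw [key x t hxt, h x t hxt, mul_zero]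
  · rintro ⟨-, h⟩
    refine ⟨hu, fun x t hxt => ?_⟩
    have h1 := key x t hxt
    rw [h _ _ (hmaps x t hxt)] at h1
    have hx : 0 < x := hpos (hWI x t hxt)
    exact (mul_eq_zero.1 h1.symm).resolve_left (div_ne_zero
      (mul_ne_zero (Real.rpow_pos_of_pos hx _).ne' hζ₁) (pow_ne_zero 2 hc))

/-- The maps `powerMap` are equivalence transformations. -/
theorem isEquivalenceTransformation_of_eqOn_powerMap {I J K L M : Set ℝ} (hb : IsBox I J K L M)
    {c ζ₀ ζ₁ : ℝ} (hc : c ≠ 0) (hζ₁ : ζ₁ ≠ 0) {F : ℝ → ℝ} (hF : ContDiffOn ℝ ∞ F I)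
    {Ψ : ExtSpace → ExtSpace}
    (hΨ : EqOn Ψ (powerMap c ζ₀ ζ₁ F) (I ×ˢ J ×ˢ K ×ˢ L ×ˢ M)) :
    IsEquivalenceTransformation (I ×ˢ J ×ˢ K ×ˢ L ×ˢ M) Ψ := by
  have hDo := hb.isOpen
  set D : Set ExtSpace := I ×ˢ J ×ˢ K ×ˢ L ×ˢ M with hD
  have hDI : ∀ z ∈ D, z.x ∈ I := fun z hz => hz.1
  have hD0 : ∀ z ∈ D, 0 < z.x := fun z hz => hb.pos hz.1
  set E : Set ExtSpace := {z | 0 < z.x ∧ z.x ^ (1 / c) ∈ I} with hE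
  set Θ : ExtSpace → ExtSpace := fun z => powerMapSolve c ζ₀ ζ₁ F (z.x ^ (1 / c)) z with hΘ
  have hΘs : ContDiffOn ℝ ∞ Θ E := contDiffOn_powerMapSolve c ζ₀ ζ₁ hb.openI hb.pos hF
  have hroot : ∀ x : ℝ, 0 < x → (x ^ c) ^ (1 / c) = x := fun x hx => by
    rw [← Real.rpow_mul hx.le, mul_one_div_cancel hc, Real.rpow_one]
  have hroot' : ∀ x : ℝ, 0 < x → (x ^ (1 / c)) ^ c = x := fun x hx => by
    rw [← Real.rpow_mul hx.le, one_div_mul_cancel hc, Real.rpow_one]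
  have hΨx : ∀ z ∈ D, (Ψ z).x = z.x ^ c := fun z hz => by rw [hΨ hz]; rfl
  have hEo : IsOpen E := by
    have h0 : IsOpen {z : ExtSpace | 0 < z.x} :=
      isOpen_lt continuous_const ContDiff.ext_coordinates.1.continuous
    have h1 : ContinuousOn (fun z : ExtSpace => z.x ^ (1 / c)) {z : ExtSpace | 0 < z.x} :=
      fun z hz => ((ContDiff.ext_coordinates.1.continuous.continuousAt).rpow_const
        (Or.inl (ne_of_gt hz))).continuousWithinAt
    exact h1.isOpen_inter_preimage h0 hb.openI
  have hinv : ∀ z ∈ D, Θ (Ψ z) = z := by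
    intro z hz
    simp only [hΘ, hΨx z hz, hroot _ (hD0 z hz)]
    rw [hΨ hz]
    exact powerMapSolve_powerMap hc hζ₁ ζ₀ F (hD0 z hz)
  -- This form of the image makes it open: `Θ` is continuous on the open set `E`.
  have himage : Ψ '' D = E ∩ Θ ⁻¹' D := by
    ext z
    constructor
    · rintro ⟨w, hw, rfl⟩
      refine ⟨⟨?_, ?_⟩, ?_⟩
      · rw [hΨx w hw]; exact Real.rpow_pos_of_pos (hD0 w hw) _
      · rw [hΨx w hw, hroot _ (hD0 w hw)]; exact hDI w hw
      · rw [mem_preimage, hinv w hw]; exact hw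
    · rintro ⟨hz, hzD⟩
      refine ⟨Θ z, hzD, ?_⟩
      rw [hΨ hzD]
      exact powerMap_powerMapSolve hc hζ₁ ζ₀ F (hb.pos hz.2) (hroot' _ hz.1)
  refine ⟨(contDiffOn_powerMap hc ζ₀ ζ₁ hb.openI hb.pos hF hDI).congr hΨ, ?_,
    ⟨Θ, hΘs.mono (by rw [himage]; exact inter_subset_left), hinv⟩, ?_, ?_, ?_⟩
  · rw [himage]
    exact hΘs.continuousOn.isOpen_inter_preimage hEo hDo
  · intro z hz
    rw [hΨx z hz]
    exact Real.rpow_pos_of_pos (hD0 z hz) _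
  · intro z hz w hw h1 h2 h3
    rw [hΨ hz, hΨ hw]
    change z.x ^ c = w.x ^ c ∧ ζ₀ + c ^ 2 * z.t = ζ₀ + c ^ 2 * w.t ∧
      z.x ^ ((c - 1) / 2) * (ζ₁ * z.u + F z.x) = w.x ^ ((c - 1) / 2) * (ζ₁ * w.u + F w.x)
    rw [h1, h2, h3]
    exact ⟨rfl, rfl, rfl⟩
  · intro γ f V hV hfs
    set R : ℝ → ℝ → ℝ := fun x w => (x ^ (-((c - 1) / 2)) * w - F x) / ζ₁ with hR
    set G : ℝ → ℝ → ℝ := fun x u => (1 / 4 : ℝ) * x ^ ((c - 5) / 2) *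
      ((1 / c ^ 2 - 1) * x ^ (2 * γ) * (ζ₁ * u + F x)
        + 4 / c ^ 2 * x ^ 2 * (ζ₁ * f x u + x ^ (2 * γ) * iteratedDeriv 2 F x)) with hG
    have hRu : ∀ x u : ℝ, 0 < x → R x (x ^ ((c - 1) / 2) * (ζ₁ * u + F x)) = u := by
      intro x u hx
      have := (Real.rpow_pos_of_pos hx ((c - 1) / 2)).ne'
      simp only [hR, Real.rpow_neg hx.le]
      field_simp
      ring
    -- The new element is the formula `G`, with the old `x` and `u` expressed through the new ones.
    set f' : ℝ → ℝ → ℝ := fun a w => G (a ^ (1 / c)) (R (a ^ (1 / c)) w) with hf'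
    have hf'G : ∀ x u : ℝ, 0 < x → f' (x ^ c) (x ^ ((c - 1) / 2) * (ζ₁ * u + F x)) = G x u := by
      intro x u hx
      simp only [hf', hroot x hx, hRu x u hx]
    have hel : ∀ z ∈ elementGraph γ f V ∩ D, (Ψ z).γ = 1 + (γ - 1) / c ∧
        (Ψ z).f = f' (Ψ z).x (Ψ z).u := by
      rintro z ⟨⟨hzV, hzγ, hzf⟩, hz⟩
      rw [hΨ hz]
      constructor
      · change 1 + (z.γ - 1) / c = _
        rw [hzγ]
      · refine Eq.trans ?_ (hf'G z.x z.u (hD0 z hz)).symm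
        change (1 / 4 : ℝ) * z.x ^ ((c - 5) / 2) *
          ((1 / c ^ 2 - 1) * z.x ^ (2 * z.γ) * (ζ₁ * z.u + F z.x)
            + 4 / c ^ 2 * z.x ^ 2 * (ζ₁ * z.f + z.x ^ (2 * z.γ) * iteratedDeriv 2 F z.x)) = _
        rw [hzγ, hzf]
    refine ⟨1 + (γ - 1) / c, f', ?_, hel, ?_⟩
    · rintro _ ⟨z, ⟨⟨hzV, hzγ, hzf⟩, hz⟩, rfl⟩
      have hz0 := hD0 z hz
      have hzI := hDI z hz
      have e1 : (Ψ z).x = z.x ^ c := hΨx z hz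
      have e2 : (Ψ z).u = z.x ^ ((c - 1) / 2) * (ζ₁ * z.u + F z.x) := by rw [hΨ hz]; rfl
      -- The formula for `f'` is smooth on a full neighbourhood of the point, because `F` and `f`
      -- are smooth on open sets, so the shape of the image set plays no role.
      refine ContDiffAt.contDiffWithinAt ?_
      have hp : ContDiffAt ℝ ∞ (fun a : ℝ × ℝ => a.1 ^ (1 / c)) ((Ψ z).x, (Ψ z).u) := by
        refine contDiffAt_fst.rpow_const_of_ne ?_
        rw [e1]
        exact (Real.rpow_pos_of_pos hz0 _).ne'
      have hp0 : (Ψ z).x ^ (1 / c) = z.x := by rw [e1, hroot _ hz0]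
      have hpow : ∀ a : ℝ, ContDiffAt ℝ ∞ (fun b : ℝ × ℝ => (b.1 ^ (1 / c)) ^ a)
          ((Ψ z).x, (Ψ z).u) := by
        intro a
        refine hp.rpow_const_of_ne ?_
        dsimp only
        rw [hp0]
        exact hz0.ne'
      have hFp : ContDiffAt ℝ ∞ (fun b : ℝ × ℝ => F (b.1 ^ (1 / c))) ((Ψ z).x, (Ψ z).u) := by
        refine ContDiffAt.comp (g := F) _ ?_ hp
        dsimp only
        rw [hp0]
        exact hF.contDiffAt (hb.openI.mem_nhds hzI)
      have hFp2 : ContDiffAt ℝ ∞ (fun b : ℝ × ℝ => iteratedDeriv 2 F (b.1 ^ (1 / c)))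
          ((Ψ z).x, (Ψ z).u) := by
        refine ContDiffAt.comp (g := iteratedDeriv 2 F) _ ?_ hp
        dsimp only
        rw [hp0]
        exact (hF.iteratedDeriv_two hb.openI).contDiffAt (hb.openI.mem_nhds hzI)
      have hRs : ContDiffAt ℝ ∞ (fun b : ℝ × ℝ => R (b.1 ^ (1 / c)) b.2) ((Ψ z).x, (Ψ z).u) :=
        (((hpow _).mul contDiffAt_snd).sub hFp).div_const ζ₁
      have hfR : ContDiffAt ℝ ∞ (fun b : ℝ × ℝ => f (b.1 ^ (1 / c)) (R (b.1 ^ (1 / c)) b.2))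
          ((Ψ z).x, (Ψ z).u) := by
        refine ContDiffAt.comp (g := Function.uncurry f) (f := fun b : ℝ × ℝ =>
          (b.1 ^ (1 / c), R (b.1 ^ (1 / c)) b.2)) _ ?_ (hp.prodMk hRs)
        dsimp only
        rw [hp0, e2, hRu _ _ hz0]
        exact hfs.contDiffAt (hV.mem_nhds hzV)
      exact (contDiffAt_const.mul (hpow _)).mul
        (((contDiffAt_const.mul (hpow _)).mul ((contDiffAt_const.mul hRs).add hFp)).add
        ((contDiffAt_const.mul (hp.pow 2)).mul ((contDiffAt_const.mul hfR).add
          ((hpow _).mul hFp2))))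
    · intro W W' u v hW hW' hu hv hsub himg
      have hmem : ∀ x t, (x, t) ∈ W →
          ((x, t, u x t, γ, f x (u x t)) : ExtSpace) ∈ elementGraph γ f V ∩ D :=
        fun x t h => hsub ⟨(x, t), h, rfl⟩
      have himg1 : ∀ x t, (x, t) ∈ W → (x ^ c, ζ₀ + c ^ 2 * t) ∈ W' ∧
          v (x ^ c) (ζ₀ + c ^ 2 * t) = x ^ ((c - 1) / 2) * (ζ₁ * u x t + F x) := by
        intro x t h
        have h1 : Ψ (x, t, u x t, γ, f x (u x t)) ∈
            liftedGraph (1 + (γ - 1) / c) f' W' v := by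
          rw [← himg]; exact ⟨_, ⟨(x, t), h, rfl⟩, rfl⟩
        obtain ⟨⟨a, b⟩, hab, he⟩ := h1
        rw [hΨ (hmem x t h).2] at he
        have ha : a = x ^ c := congrArg (fun z : ExtSpace => z.1) he
        have hb' : b = ζ₀ + c ^ 2 * t := congrArg (fun z : ExtSpace => z.2.1) he
        have hv' : v a b = x ^ ((c - 1) / 2) * (ζ₁ * u x t + F x) :=
          congrArg (fun z : ExtSpace => z.2.2.1) he
        subst ha hb'
        exact ⟨hab, hv'⟩
      refine isSolutionOn_iff_of_transform hc hζ₁ hb.openI hb.pos hF hW hW' hu hv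
        (fun x t h => (hmem x t h).2.1) (fun x t h => (himg1 x t h).1) ?_
        (fun x t h => (himg1 x t h).2) ?_
      · intro a b hab
        have h1 : ((a, b, v a b, 1 + (γ - 1) / c, f' a (v a b)) : ExtSpace) ∈
            Ψ '' liftedGraph γ f W u := by
          rw [himg]; exact ⟨(a, b), hab, rfl⟩
        obtain ⟨_, ⟨⟨x, t⟩, hxt, rfl⟩, he⟩ := h1
        rw [hΨ (hmem x t hxt).2] at he
        exact ⟨x, t, hxt, (congrArg (fun z : ExtSpace => z.1) he).symm,
          (congrArg (fun z : ExtSpace => z.2.1) he).symm⟩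
      · intro x t h
        rw [(himg1 x t h).2]
        exact hf'G x (u x t) (hb.pos (hmem x t h).2.1)

/-! ### The original parameters, the reflection and the identity. -/

/-- Only positive exponents arise in this way, whereas `powerMap` makes sense for negative ones too.
-/
theorem familyMap_eq_powerMap (ζ₀ ζ₁ : ℝ) {ζ₂ : ℝ} (hζ₂ : ζ₂ ≠ 0) (F : ℝ → ℝ) :
    familyMap ζ₀ ζ₁ ζ₂ F = powerMap (1 / ζ₂ ^ 2) ζ₀ ζ₁ F := by
  funext z
  have e1 : (1 / 2 : ℝ) * (1 / ζ₂ ^ 2 - 1) = (1 / ζ₂ ^ 2 - 1) / 2 := by ring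
  have e2 : (1 / 2 : ℝ) * (1 / ζ₂ ^ 2 - 5) = (1 / ζ₂ ^ 2 - 5) / 2 := by ring
  have e3 : (1 / ζ₂ ^ 2) ^ 2 = 1 / ζ₂ ^ 4 := by field_simp
  have e4 : 1 / (1 / ζ₂ ^ 4) = ζ₂ ^ 4 := by field_simp
  have e5 : 4 / (1 / ζ₂ ^ 4) = 4 * ζ₂ ^ 4 := by field_simp
  have e6 : (z.γ - 1) / (1 / ζ₂ ^ 2) = ζ₂ ^ 2 * (z.γ - 1) := by field_simp
  simp only [familyMap, powerMap, e1, e2, e3, e4, e5, e6]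

theorem exists_one_div_sq_eq {c : ℝ} (hc : 0 < c) : ∃ ζ₂ : ℝ, ζ₂ ≠ 0 ∧ 1 / ζ₂ ^ 2 = c := by
  refine ⟨1 / √c, one_div_ne_zero (Real.sqrt_pos.2 hc).ne', ?_⟩
  rw [div_pow, one_pow, Real.sq_sqrt hc.le, one_div_one_div]

theorem reflection_reflection (z : ExtSpace) : reflection (reflection z) = z := by
  obtain ⟨x, t, u, γ, f⟩ := z
  simp [reflection, ExtSpace.x, ExtSpace.t, ExtSpace.u, ExtSpace.γ, ExtSpace.f]

theorem reflection_powerMap (c ζ₀ ζ₁ : ℝ) (F : ℝ → ℝ) (z : ExtSpace) :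
    reflection (powerMap c ζ₀ ζ₁ F z) = powerMap c ζ₀ (-ζ₁) (-F) z := by
  have h : iteratedDeriv 2 (-F) z.x = -iteratedDeriv 2 F z.x := iteratedDeriv_neg 2 F z.x
  simp only [powerMap, h, Pi.neg_apply]
  refine Prod.ext rfl (Prod.ext rfl (Prod.ext ?_ (Prod.ext rfl ?_)))
  · change -(z.x ^ ((c - 1) / 2) * (ζ₁ * z.u + F z.x)) = _
    ring
  · change -((1 / 4 : ℝ) * z.x ^ ((c - 5) / 2) *
      ((1 / c ^ 2 - 1) * z.x ^ (2 * z.γ) * (ζ₁ * z.u + F z.x)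
       + 4 / c ^ 2 * z.x ^ 2 * (ζ₁ * z.f + z.x ^ (2 * z.γ) * iteratedDeriv 2 F z.x))) = _
    ring

theorem powerMap_one {z : ExtSpace} (hz : 0 < z.x) : powerMap 1 0 1 (fun _ => 0) z = z := by
  obtain ⟨x, t, u, γ, f⟩ := z
  change 0 < x at hz
  have h1 : ((1 : ℝ) - 1) / 2 = 0 := by norm_num
  have h2 : x ^ (((1 : ℝ) - 5) / 2) = (x ^ 2)⁻¹ := by
    rw [show ((1 : ℝ) - 5) / 2 = -2 by norm_num, Real.rpow_neg hz.le, Real.rpow_two]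
  have h3 : iteratedDeriv 2 (fun _ : ℝ => (0 : ℝ)) x = 0 := by simp
  have hx := hz.ne'
  simp only [powerMap, ExtSpace.x, ExtSpace.t, ExtSpace.u, ExtSpace.γ, ExtSpace.f, h1, h2, h3,
    Real.rpow_one, Real.rpow_zero]
  refine Prod.ext rfl (Prod.ext ?_ (Prod.ext ?_ (Prod.ext ?_ ?_)))
  · simp
  · simp
  · simp
  · field_simp
    ring

/-! ### The continuous part. -/

theorem pos_of_continuousOn_of_ne_zero {h : ℝ → ℝ} (hc : ContinuousOn h (Icc 0 1))
    (hne : ∀ s ∈ Icc (0 : ℝ) 1, h s ≠ 0) (h0 : 0 < h 0) : 0 < h 1 := by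
  by_contra h1
  obtain ⟨s, hs, hs0⟩ := intermediate_value_Icc' zero_le_one hc ⟨not_lt.1 h1, h0.le⟩
  exact hne s hs hs0

section

variable {I J K L M : Set ℝ} {Ψ : ExtSpace → ExtSpace}

/-- The parameters with `c > 0` and `ζ₁ > 0` form a convex set containing those of the identity,
namely `c = 1`, `ζ₀ = 0`, `ζ₁ = 1`, `F = 0`; the segment between the two is the required family. -/
theorem inContinuousPart_of_eqOn_powerMap (hb : IsBox I J K L M) {c ζ₀ ζ₁ : ℝ} (hc : 0 < c)
    (hζ₁ : 0 < ζ₁) {F : ℝ → ℝ} (hF : ContDiffOn ℝ ∞ F I)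
    (hΨ : EqOn Ψ (powerMap c ζ₀ ζ₁ F) (I ×ˢ J ×ˢ K ×ˢ L ×ˢ M)) :
    InContinuousPart (I ×ˢ J ×ˢ K ×ˢ L ×ˢ M) Ψ := by
  have hpos : ∀ a : ℝ, 0 < a → ∀ s ∈ Icc (0 : ℝ) 1, 0 < 1 - s + s * a := by
    intro a ha s hs
    rcases eq_or_lt_of_le hs.1 with h | h
    · rw [← h]; norm_num
    · have := mul_pos h ha
      linarith [hs.2]
  refine ⟨fun s z => powerMap (1 - s + s * c) (s * ζ₀) (1 - s + s * ζ₁) (fun x => s * F x) z,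
    ?_, ?_, ?_, ?_⟩
  · rintro ⟨s, z⟩ ⟨hs, hz⟩
    have hfst : ContDiff ℝ ∞ (fun q : ℝ × ExtSpace => q.1) := contDiff_fst
    have hlin : ∀ a : ℝ, ContDiff ℝ ∞ (fun q : ℝ × ExtSpace => 1 - q.1 + q.1 * a) := fun a =>
      (contDiff_const.sub hfst).add (hfst.mul contDiff_const)
    exact ContDiffWithinAt.powerMap (hlin c).contDiffWithinAt
      (hfst.mul contDiff_const).contDiffWithinAt (hlin ζ₁).contDiffWithinAt hfst.contDiffWithinAt
      contDiff_snd.contDiffWithinAt (hpos c hc s hs).ne' hb.openI hF hz.1 (hb.pos hz.1)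
  · intro s hs
    exact isEquivalenceTransformation_of_eqOn_powerMap hb (hpos c hc s hs).ne'
      (hpos ζ₁ hζ₁ s hs).ne' (contDiffOn_const.mul hF) (fun z _ => rfl)
  · intro z hz
    have h := powerMap_one (z := z) (hb.pos hz.1)
    simpa using h
  · intro z hz
    rw [hΨ hz]
    simp

theorem InContinuousPart.exists_continuous_family {D : Set ExtSpace}
    (h : InContinuousPart D Ψ) :
    ∃ H : ℝ → ExtSpace → ExtSpace, (∀ z ∈ D, ContinuousOn (fun s => H s z) (Icc 0 1)) ∧
      (∀ s ∈ Icc (0 : ℝ) 1, IsEquivalenceTransformation D (H s)) ∧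
      EqOn (H 0) id D ∧ EqOn (H 1) Ψ D := by
  obtain ⟨H, hs, he, h0, h1⟩ := h
  refine ⟨H, fun z hz => ?_, he, h0, h1⟩
  exact hs.continuousOn.comp (f := fun s : ℝ => (s, z))
    (continuous_id.prodMk continuous_const).continuousOn fun s hs' => ⟨hs', hz⟩

/-- Each member of the path is a power map, but its parameters are not known to vary continuously.
Their signs are therefore read off from the images of two fixed points, which do vary continuously,
and a continuous nonvanishing function keeps its sign. -/
theorem InContinuousPart.exists_powerMap (hb : IsBox I J K L M)
    (h : InContinuousPart (I ×ˢ J ×ˢ K ×ˢ L ×ˢ M) Ψ) :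
    ∃ (c ζ₀ ζ₁ : ℝ) (F : ℝ → ℝ), 0 < c ∧ 0 < ζ₁ ∧ ContDiffOn ℝ ∞ F I ∧
      EqOn Ψ (powerMap c ζ₀ ζ₁ F) (I ×ˢ J ×ˢ K ×ˢ L ×ˢ M) := by
  obtain ⟨H, hcont, he, h0, h1⟩ := h.exists_continuous_family
  obtain ⟨c, ζ₀, ζ₁, F, -, -, hF, hΨ⟩ :=
    (he 1 ⟨zero_le_one, le_rfl⟩).exists_powerMap hb
  obtain ⟨x, hx, hx1, -⟩ := exists_ne_ne_of_isOpen hb.openI hb.connI.nonempty 1 1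
  obtain ⟨t, ht⟩ := hb.connJ.nonempty
  obtain ⟨u, hu⟩ := hb.connK.nonempty
  obtain ⟨w, hw, hwu, -⟩ := exists_ne_ne_of_isOpen hb.openK hb.connK.nonempty u u
  obtain ⟨γ, hγ⟩ := hb.connL.nonempty
  obtain ⟨f, hf⟩ := hb.connM.nonempty
  have hx0 : 0 < x := hb.pos hx
  have hlx : Real.log x ≠ 0 := Real.log_ne_zero_of_pos_of_ne_one hx0 hx1
  set z₁ : ExtSpace := (x, t, u, γ, f) with hz₁
  set z₂ : ExtSpace := (x, t, w, γ, f) with hz₂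
  have hm₁ : z₁ ∈ I ×ˢ J ×ˢ K ×ˢ L ×ˢ M := ⟨hx, ht, hu, hγ, hf⟩
  have hm₂ : z₂ ∈ I ×ˢ J ×ˢ K ×ˢ L ×ˢ M := ⟨hx, ht, hw, hγ, hf⟩
  have hsub : w - u ≠ 0 := sub_ne_zero.2 hwu
  -- The extra factor `log x` makes the sign that of `c` whether `x` lies above or below `1`; the
  -- factor `w - u` in `e2` plays the same role for `ζ₁`.
  have e1 : ∀ {c ζ₀ ζ₁ : ℝ} {F : ℝ → ℝ} {G : ExtSpace → ExtSpace},
      EqOn G (powerMap c ζ₀ ζ₁ F) (I ×ˢ J ×ˢ K ×ˢ L ×ˢ M) →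
      Real.log (G z₁).1 * Real.log x = c * Real.log x ^ 2 := by
    intro c ζ₀ ζ₁ F G hG
    rw [hG hm₁]
    change Real.log (x ^ c) * _ = _
    rw [Real.log_rpow hx0]
    ring
  have e2 : ∀ {c ζ₀ ζ₁ : ℝ} {F : ℝ → ℝ} {G : ExtSpace → ExtSpace},
      EqOn G (powerMap c ζ₀ ζ₁ F) (I ×ˢ J ×ˢ K ×ˢ L ×ˢ M) →
      ((G z₂).2.2.1 - (G z₁).2.2.1) * (w - u) = x ^ ((c - 1) / 2) * ζ₁ * (w - u) ^ 2 := by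
    intro c ζ₀ ζ₁ F G hG
    rw [hG hm₁, hG hm₂]
    change (x ^ ((c - 1) / 2) * (ζ₁ * w + F x) - x ^ ((c - 1) / 2) * (ζ₁ * u + F x)) * (w - u) = _
    ring
  have p1 : 0 < Real.log (H 1 z₁).1 * Real.log x := by
    refine pos_of_continuousOn_of_ne_zero (h := fun s => Real.log (H s z₁).1 * Real.log x) ?_ ?_ ?_
    · refine ContinuousOn.mul (ContinuousOn.log (continuous_fst.comp_continuousOn (hcont z₁ hm₁))
        fun s hs => ((he s hs).pos z₁ hm₁).ne') continuousOn_const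
    · intro s hs
      obtain ⟨c', _, _, _, hc', -, -, hG⟩ := (he s hs).exists_powerMap hb
      rw [e1 hG]
      exact mul_ne_zero hc' (pow_ne_zero 2 hlx)
    · rw [h0 hm₁]
      exact mul_self_pos.2 hlx
  have p2 : 0 < ((H 1 z₂).2.2.1 - (H 1 z₁).2.2.1) * (w - u) := by
    refine pos_of_continuousOn_of_ne_zero
      (h := fun s => ((H s z₂).2.2.1 - (H s z₁).2.2.1) * (w - u)) ?_ ?_ ?_
    · have hcu : Continuous (fun z : ExtSpace => z.2.2.1) :=
        ContDiff.ext_coordinates.2.2.1.continuous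
      exact ((hcu.comp_continuousOn (hcont z₂ hm₂)).sub
        (hcu.comp_continuousOn (hcont z₁ hm₁))).mul continuousOn_const
    · intro s hs
      obtain ⟨c', _, _, _, -, hζ', -, hG⟩ := (he s hs).exists_powerMap hb
      rw [e2 hG]
      exact mul_ne_zero (mul_ne_zero (Real.rpow_pos_of_pos hx0 _).ne' hζ') (pow_ne_zero 2 hsub)
    · rw [h0 hm₁, h0 hm₂]
      exact mul_self_pos.2 hsub
  rw [e1 hΨ] at p1
  rw [e2 hΨ] at p2
  refine ⟨c, ζ₀, ζ₁, F, pos_of_mul_pos_left p1 (sq_nonneg _), ?_, hF, fun z hz => ?_⟩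
  · have h3 := pos_of_mul_pos_left p2 (sq_nonneg _)
    exact pos_of_mul_pos_right h3 (Real.rpow_pos_of_pos hx0 _).le
  · rw [← h1 hz]
    exact hΨ hz

end

/-! ### The classification. -/

theorem mainTheorem4 (I J K L M : Set ℝ)
    (hI : IsOpen I) (hJ : IsOpen J) (hK : IsOpen K) (hL : IsOpen L) (hM : IsOpen M)
    (hI' : IsConnected I) (hJ' : IsConnected J) (hK' : IsConnected K)
    (hL' : IsConnected L) (hM' : IsConnected M)
    (hpos : I ⊆ Ioi 0) (Ψ : ExtSpace → ExtSpace) :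
    (InContinuousPart (I ×ˢ J ×ˢ K ×ˢ L ×ˢ M) Ψ ↔
      ∃ (ζ₀ ζ₁ ζ₂ : ℝ) (F : ℝ → ℝ), 0 < ζ₁ ∧ ζ₂ ≠ 0 ∧ ContDiffOn ℝ ∞ F I ∧
        EqOn Ψ (familyMap ζ₀ ζ₁ ζ₂ F) (I ×ˢ J ×ˢ K ×ˢ L ×ˢ M)) ∧
    ((IsEquivalenceTransformation (I ×ˢ J ×ˢ K ×ˢ L ×ˢ M) Ψ ∧
        (InContinuousPart (I ×ˢ J ×ˢ K ×ˢ L ×ˢ M) Ψ ∨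
          InContinuousPart (I ×ˢ J ×ˢ K ×ˢ L ×ˢ M) (reflection ∘ Ψ))) ↔
      ∃ (ζ₀ ζ₁ ζ₂ : ℝ) (F : ℝ → ℝ), ζ₁ * ζ₂ ≠ 0 ∧ ContDiffOn ℝ ∞ F I ∧
        EqOn Ψ (familyMap ζ₀ ζ₁ ζ₂ F) (I ×ˢ J ×ˢ K ×ˢ L ×ˢ M)) := by
  have hb : IsBox I J K L M := ⟨hI, hJ, hK, hL, hM, hI', hJ', hK', hL', hM', hpos⟩
  refine ⟨⟨fun h => ?_, ?_⟩, ⟨?_, ?_⟩⟩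
  · obtain ⟨c, ζ₀, ζ₁, F, hc, hζ₁, hF, he⟩ := h.exists_powerMap hb
    obtain ⟨ζ₂, hζ₂, rfl⟩ := exists_one_div_sq_eq hc
    exact ⟨ζ₀, ζ₁, ζ₂, F, hζ₁, hζ₂, hF, by rwa [familyMap_eq_powerMap _ _ hζ₂]⟩
  · rintro ⟨ζ₀, ζ₁, ζ₂, F, hζ₁, hζ₂, hF, he⟩
    rw [familyMap_eq_powerMap _ _ hζ₂] at he
    exact inContinuousPart_of_eqOn_powerMap hb (by positivity) hζ₁ hF he
  · rintro ⟨-, h | h⟩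
    · obtain ⟨c, ζ₀, ζ₁, F, hc, hζ₁, hF, he⟩ := h.exists_powerMap hb
      obtain ⟨ζ₂, hζ₂, rfl⟩ := exists_one_div_sq_eq hc
      exact ⟨ζ₀, ζ₁, ζ₂, F, mul_ne_zero hζ₁.ne' hζ₂, hF,
        by rwa [familyMap_eq_powerMap _ _ hζ₂]⟩
    · obtain ⟨c, ζ₀, ζ₁, F, hc, hζ₁, hF, he⟩ := h.exists_powerMap hb
      obtain ⟨ζ₂, hζ₂, rfl⟩ := exists_one_div_sq_eq hc
      -- As `reflection` is an involution, `Ψ` is the reflection of the map found for the composite,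
      -- so `ζ₁` and `F` change sign.
      refine ⟨ζ₀, -ζ₁, ζ₂, -F, mul_ne_zero (neg_ne_zero.2 hζ₁.ne') hζ₂, hF.neg, fun z hz => ?_⟩
      rw [familyMap_eq_powerMap _ _ hζ₂, ← reflection_powerMap, ← he hz]
      exact (reflection_reflection (Ψ z)).symm
  · rintro ⟨ζ₀, ζ₁, ζ₂, F, hζ, hF, he⟩
    have hζ₁ := left_ne_zero_of_mul hζ
    have hζ₂ := right_ne_zero_of_mul hζ
    rw [familyMap_eq_powerMap _ _ hζ₂] at he
    have hc : 0 < 1 / ζ₂ ^ 2 := by positivity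
    refine ⟨isEquivalenceTransformation_of_eqOn_powerMap hb hc.ne' hζ₁ hF he, ?_⟩
    rcases lt_or_gt_of_ne hζ₁ with h | h
    · refine Or.inr (inContinuousPart_of_eqOn_powerMap hb hc (neg_pos.2 h) (ζ₀ := ζ₀) hF.neg
        fun z hz => ?_)
      rw [Function.comp_apply, he hz]
      exact reflection_powerMap _ _ _ _ _
    · exact Or.inl (inContinuousPart_of_eqOn_powerMap hb hc h hF he)
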